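/- **Setting.** Let $\tilde X$ be a locally compact metric space with an isometric action of a discrete group $G$ such that $p:\tilde X\to X:=\tilde X/G$ is a quotient covering map (every point has a neighbourhood $U$ with $gU\cap U=\emptyset$ for $g\ne1$) and $X$ is compact. Let $\tilde r$ be a homeomorphism of $\tilde X$ with $d(x,y)\le\theta\, d(\tilde rx,\tilde ry)$ for some $0<\theta<1$, let $\tilde x_0$ be its fixed point, $x_0=p(\tilde x_0)$, and let $A\in\mathrm{End}(G)$ satisfy $\tilde r(g\tilde x)=(Ag)\tilde r\tilde x$, with $AG$ normal in $G$. Put $r(p\tilde x)=p(\tilde r\tilde x)$. Let $g_1=1,\dots,g_q$ represent the right cosets of $AG$ in $G$ and let $\psi_i=\tilde r^{-1}\circ g_i$. Let $\xi\to X$ be a Lipschitz $d$-dimensional Hermitian complex vector bundle such that $p^*\xi$ is trivial, and fix a trivialization of $p^*\xi$ by fibrewise isometries $\sigma_{\tilde x}:\mathbb C^d\to\xi_{p\tilde x}$ that is Lipschitz with respect to a Lipschitz system of local trivializations of $\xi$. Let $S$ be the $C(X)$-module of continuous sections of $\xi$. For $s\in S$ write $p^*s(\tilde x)=\sigma_{\tilde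 x}^{-1}s(p\tilde x)\in\mathbb C^d$, and let $S_1\subset S$ consist of the $s$ with $p^*s$ Lipschitz. Let $m:r^*\xi\to\xi$ be a continuous bundle map whose matrix $m(\tilde x):=\sigma_{\tilde x}^{-1}\,m\,\sigma_{\tilde r\tilde x}\in M_d(\mathbb C)$ is Lipschitz in $\tilde x\in\tilde X$. Inner products are linear in the second variable. Put $m^{(k)}(\tilde x)=m(\tilde x)m(\tilde r\tilde x)\cdots m(\tilde r^{k-1}\tilde x)$ and $$(Rh)(p\tilde x)=\sum_{i=1}^q m^*(p\psi_i\tilde x)\,h(p\psi_i\tilde x)\,m(p\psi_i\tilde x),\qquad h\in\mathrm{End}(\xi).$$ For $f_1,f_2:\tilde X\to\mathbb C$ put $\langle f_1,f_2\rangle'=\sum_{g\in G}\overline{f_1\circ g}\,f_2\circ g$. Let $\Xi$ be the set of bounded continuous $f:\tilde X\to\mathbb C$ with $\langle f,f\rangle'$ finite, bounded and continuous, and let $\Xi_1$ be the set of $f\in\Xi$ for which there is $C>0$ with $\bigl(\sum_g|f(gx)-f(gy)|^2\bigr)^{1/2}\le C\,d(x,y)$ for all $x,y\in\tilde X$. Let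 $\mathrm{Hom}(S,\Xi)$ be the set of adjointable $C(X)$-linear maps $S\to\Xi$, and let $(MW)s=\bigl(W(m\,(s\circ r))\bigr)\circ\tilde r^{-1}$. A $d\times d$ matrix $a$ satisfies $E(l)$, $1\le l\le d$, if $\|a\|=1$, $1$ is the only eigenvalue of $a$ on the unit circle, and the geometric and algebraic multiplicities of $1$ both equal $l$. **Theorem.** Assume $R1=1$ and that $m(\tilde x_0)$ satisfies $E(l)$. Let $E_1=\{v\in\mathbb C^d: m(\tilde x_0)v=v\}$. (i) The limit $\mathcal P(\tilde x)=\lim_{k\to\infty}m^{(k)}(\tilde r^{-k}\tilde x)$ exists for all $\tilde x\in\tilde X$, uniformly on compact sets, and $\mathcal P(\tilde r^{-1}\tilde x)\,m(\tilde r^{-1}\tilde x)=\mathcal P(\tilde x)$. The matrix $\mathcal P(\tilde x_0)$ is the orthogonal projection onto $E_1$. For every $\tilde x$ the range of $\mathcal P(\tilde x)$ is contained in $E_1$, i.e. $m(\tilde x_0)\mathcal P(\tilde x)=\mathcal P(\tilde x)$. For all $g\neq1$ and $v\in E_1$, $\mathcal P(g\tilde x_0)\,\sigma_{g\tilde x_0}^{-1}\sigma_{\tilde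 x_0}v=0$ (that is, $\mathcal P(g\tilde x_0)$ kills the vector of $\xi_{x_0}$ represented by $v$; if $\xi$ is trivial with the constant trivialization this reads $\mathcal P(g\tilde x_0)v=0$). (ii) Let $f\in\Xi_1$ with $\langle f,f\rangle'=1$ and $f(g\tilde x_0)=0$ for all $g\ne1$ (so that $|f(\tilde x_0)|=1$). There are maps $\mathcal W_v$ ($v\in\xi_{x_0}$), depending only on $v$ once $f$ is fixed, such that for every $s_0\in S_1$ with $s_0(x_0)=v$ the following hold. The map $W_{s_0}s=\langle s_0,s\rangle f$ is in $\mathrm{Hom}(S,\Xi)$. For all $s\in S$, $M^kW_{s_0}s$ converges uniformly on compact sets to $\mathcal W_vs$, and $$\mathcal W_vs(\tilde x)=\langle \sigma_{\tilde x_0}^{-1}v,\ \mathcal P(\tilde x)\,p^*s(\tilde x)\rangle\, f(\tilde x_0).$$ Moreover $\mathcal W_v\in\mathrm{Hom}(S,\Xi)$, $M\mathcal W_v=\mathcal W_v$, and $\mathcal W_vs(\tilde x_0)=\langle\mathcal P(\tilde x_0)\sigma_{\tilde x_0}^{-1}v,\ \sigma_{\tilde x_0}^{-1}s(x_0)\rangle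 f(\tilde x_0)$. -/

import Mathlib

open Filter Topology Bundle
open scoped NNReal ComplexConjugate

namespace Cascade

/-- The orbit space `X = X̃ / G`, with the quotient topology. -/
abbrev Orb (G Xt : Type*) [Group G] [MulAction G Xt] : Type _ := MulAction.orbitRel.Quotient G Xt

/-- The quotient map `p : X̃ → X`. -/
def proj (G : Type*) {Xt : Type*} [Group G] [MulAction G Xt] (x : Xt) : Orb G Xt :=
  Quotient.mk (MulAction.orbitRel G Xt) x

/-- The model fibre `ℂ^d` with its canonical Hermitian inner product. -/
abbrev Cd (d : ℕ) : Type := EuclideanSpace ℂ (Fin d)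

/-- The dynamical data: a covering action of `G` on the metric space `X̃`, a strictly expansive
homeomorphism `r̃` of `X̃` with its fixed point `x̃₀`, an endomorphism `A` of `G` with normal image
intertwined with `r̃`, and a finite complete system `g₁ = 1, …, g_q` of representatives of the
right cosets of `A G` in `G`. -/
structure Dilation (G Xt : Type*) [Group G] [MetricSpace Xt] [MulAction G Xt] where
  covering : IsQuotientCoveringMap (proj G : Xt → Orb G Xt) G
  rt : Xt ≃ₜ Xt
  θ : ℝ
  θ_pos : 0 < θ
  θ_lt_one : θ < 1
  expansive : ∀ x y, dist x y ≤ dist (rt x) (rt y) * θ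
  x0 : Xt
  rt_x0 : rt x0 = x0
  A : G →* G
  normal : A.range.Normal
  rt_smul : ∀ g x, rt (g • x) = A g • rt x
  q : ℕ
  q_pos : 0 < q
  rep : Fin q → G
  rep_first : rep ⟨0, q_pos⟩ = 1
  rep_complete : ∀ g : G, ∃! i, g * (rep i)⁻¹ ∈ A.range

theorem proj_smul {G Xt : Type*} [Group G] [MulAction G Xt] (g : G) (x : Xt) :
    proj G (g • x) = proj G x :=
  Quotient.sound ⟨g, rfl⟩

namespace Dilation

variable {G Xt : Type*} [Group G] [MetricSpace Xt] [MulAction G Xt] (D : Dilation G Xt)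

/-- The induced map `r : X → X`, `r (p x) = p (r̃ x)`. -/
def r : Orb G Xt → Orb G Xt :=
  Quotient.map D.rt (by
    rintro _ b ⟨g, rfl⟩
    exact ⟨D.A g, (D.rt_smul g b).symm⟩)

theorem proj_rt (x : Xt) : proj G (D.rt x) = D.r (proj G x) := rfl

theorem continuous_r : Continuous D.r :=
  Continuous.quotient_map' D.rt.continuous _

/-- The inverse branches `ψ i = r̃⁻¹ ∘ g i`. -/
def psi (i : Fin D.q) (x : Xt) : Xt := D.rt.symm (D.rep i • x)

theorem r_proj_psi (i : Fin D.q) (x : Xt) : D.r (proj G (D.psi i x)) = proj G x := by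
  rw [← D.proj_rt, psi, Homeomorph.apply_symm_apply, proj_smul]

end Dilation

section Bundle

variable {G Xt : Type*} [Group G] [MetricSpace Xt] [MulAction G Xt]
  (d : ℕ) (E : Orb G Xt → Type*)
  [∀ x, NormedAddCommGroup (E x)] [∀ x, InnerProductSpace ℂ (E x)]
  [TopologicalSpace (TotalSpace (Cd d) E)] [FiberBundle (Cd d) E] [VectorBundle ℂ (Cd d) E]

/-- A trivialisation `X̃ × ℂ^d → p^*ξ` of the pull-back of the Hermitian bundle `ξ` (with fibres
`E x`): it is continuous, isometric on each fibre, and Lipschitz with respect to a system of local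
trivialisations of `ξ` whose transition functions are Lipschitz.  Functions on subsets of `X` are
compared through their lifts to `X̃`, which amounts to using the quotient metric on `X`. -/
structure Frame where
  σ : ∀ x : Xt, Cd d ≃ₗᵢ[ℂ] E (proj G x)
  continuous_σ : Continuous fun z : Xt × Cd d =>
    (TotalSpace.mk' (Cd d) (proj G z.1) (σ z.1 z.2) : TotalSpace (Cd d) E)
  lipschitz : ∃ 𝒜 : Set (Trivialization (Cd d) (π (Cd d) E)),
    (∀ e ∈ 𝒜, e.IsLinear ℂ) ∧
    (∀ x, ∃ e ∈ 𝒜, x ∈ e.baseSet) ∧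
    (∀ e ∈ 𝒜, ∀ e' ∈ 𝒜, ∃ K : ℝ, ∀ x y : Xt,
      proj G x ∈ e.baseSet ∩ e'.baseSet → proj G y ∈ e.baseSet ∩ e'.baseSet → ∀ v : Cd d,
        ‖e.coordChange e' (proj G x) v - e.coordChange e' (proj G y) v‖ ≤ K * dist x y * ‖v‖) ∧
    (∀ e ∈ 𝒜, ∃ K : ℝ, ∀ x y : Xt, proj G x ∈ e.baseSet → proj G y ∈ e.baseSet → ∀ v : Cd d,
        ‖(e ⟨proj G x, σ x v⟩).2 - (e ⟨proj G y, σ y v⟩).2‖ ≤ K * dist x y * ‖v‖)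

/-- The space `S` of continuous sections of `ξ`. -/
def Sec : Submodule ℂ (∀ x, E x) where
  carrier := {s | Continuous fun x => TotalSpace.mk' (Cd d) x (s x)}
  zero_mem' := Bundle.Trivialization.continuous_zeroSection ℂ
  add_mem' := by
    intro s t hs ht
    refine continuous_iff_continuousAt.2 fun x => ?_
    have h1 := (FiberBundle.continuousAt_section (F := Cd d) x).1 (hs.continuousAt (x := x))
    have h2 := (FiberBundle.continuousAt_section (F := Cd d) x).1 (ht.continuousAt (x := x))
    rw [FiberBundle.continuousAt_section]
    refine (h1.add h2).congr ?_
    filter_upwards [(trivializationAt (Cd d) E x).open_baseSet.mem_nhds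
      (mem_baseSet_trivializationAt (Cd d) E x)] with y hy
    exact (((trivializationAt (Cd d) E x).linear ℂ hy).map_add (s y) (t y)).symm
  smul_mem' := by
    intro c s hs
    refine continuous_iff_continuousAt.2 fun x => ?_
    have h1 := (FiberBundle.continuousAt_section (F := Cd d) x).1 (hs.continuousAt (x := x))
    rw [FiberBundle.continuousAt_section]
    refine (h1.const_smul c).congr ?_
    filter_upwards [(trivializationAt (Cd d) E x).open_baseSet.mem_nhds
      (mem_baseSet_trivializationAt (Cd d) E x)] with y hy
    exact (((trivializationAt (Cd d) E x).linear ℂ hy).map_smul c (s y)).symm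

variable {d E}

/-- The action of `C(X)` on `S`. -/
noncomputable def Sec.mul (a : C(Orb G Xt, ℂ)) (s : Sec d E) : Sec d E :=
  ⟨fun x => a x • s.1 x, by
    refine continuous_iff_continuousAt.2 fun x => ?_
    have h1 := (FiberBundle.continuousAt_section (F := Cd d) x).1 (s.2.continuousAt (x := x))
    rw [FiberBundle.continuousAt_section]
    refine (a.continuous.continuousAt.smul h1).congr ?_
    filter_upwards [(trivializationAt (Cd d) E x).open_baseSet.mem_nhds
      (mem_baseSet_trivializationAt (Cd d) E x)] with y hy
    exact (((trivializationAt (Cd d) E x).linear ℂ hy).map_smul (a y) (s.1 y)).symm⟩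

namespace Frame

variable (Fr : Frame d E)

/-- The isometry `ℂ^d → E x` given by the trivialisation at a point `z` lying over `x`. -/
def at' (z : Xt) {x : Orb G Xt} (h : proj G z = x) : Cd d ≃ₗᵢ[ℂ] E x :=
  Eq.rec (motive := fun y _ => Cd d ≃ₗᵢ[ℂ] E y) (Fr.σ z) h

/-- For `v ∈ ℂ^d`, the coordinates at `g z` of the vector of `ξ` whose coordinates at `z`
are `v`. -/
noncomputable def change (g : G) (z : Xt) : Cd d ≃ₗᵢ[ℂ] Cd d :=
  (Fr.σ z).trans (Fr.at' (g • z) (proj_smul g z)).symm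

/-- The lift `p^* s : X̃ → ℂ^d` of a section. -/
noncomputable def lift (s : Sec d E) (x : Xt) : Cd d := (Fr.σ x).symm (s.1 (proj G x))

/-- Membership in `S₁`: the lift of the section is Lipschitz. -/
def IsLip (s : Sec d E) : Prop := ∃ K : ℝ≥0, LipschitzWith K (Fr.lift s)

set_option linter.unusedSectionVars false in
theorem complete (Fr : Frame d E) (x : Orb G Xt) : CompleteSpace (E x) := by
  obtain ⟨z, rfl⟩ := Quotient.exists_rep x
  have : FiniteDimensional ℂ (E (proj G z)) := (Fr.σ z).toLinearEquiv.finiteDimensional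
  exact FiniteDimensional.complete ℂ (E (proj G z))

end Frame

variable (D : Dilation G Xt) (Fr : Frame d E)

/-- The matrix `p^* m` at `x ∈ X̃` of a family of maps `m x : E (r x) → E x`. -/
noncomputable def matrixOf (m : ∀ x, E (D.r x) →L[ℂ] E x) (x : Xt) : Cd d →L[ℂ] Cd d :=
  ((Fr.σ x).symm.toContinuousLinearEquiv : E (proj G x) →L[ℂ] Cd d) ∘L m (proj G x) ∘L
    ((Fr.at' (D.rt x) (D.proj_rt x)).toContinuousLinearEquiv : Cd d →L[ℂ] E (D.r (proj G x)))

/-- A Lipschitz continuous bundle map `m : r^*ξ → ξ`. -/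
structure Weight where
  m : ∀ x, E (D.r x) →L[ℂ] E x
  continuous_m : Continuous fun z : TotalSpace (Cd d) (D.r *ᵖ E) =>
    (TotalSpace.mk' (Cd d) z.1 (m z.1 z.2) : TotalSpace (Cd d) E)
  lipschitz_m : ∃ K : ℝ≥0, LipschitzWith K (matrixOf D Fr m)

namespace Weight

variable {D Fr} (w : Weight D Fr)

/-- The matrix-valued function `p^* m : X̃ → M_d(ℂ)`. -/
noncomputable def mat (x : Xt) : Cd d →L[ℂ] Cd d := matrixOf D Fr w.m x

/-- `m y` as a map `E x → E y`, for `y ∈ r⁻¹ x`. -/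
def mAt {x y : Orb G Xt} (h : D.r y = x) : E x →L[ℂ] E y :=
  Eq.rec (motive := fun x' _ => E x' →L[ℂ] E y) (w.m y) h

/-- The transfer operator:
`(R h) (p x) = ∑ i, m^*(p (ψ i x)) h (p (ψ i x)) m (p (ψ i x))`.  The right side depends on `x`
only through `p x`. -/
noncomputable def transfer (h : ∀ x, E x →L[ℂ] E x) (x : Xt) :
    E (proj G x) →L[ℂ] E (proj G x) :=
  haveI := Fr.complete
  ∑ i : Fin D.q, (w.mAt (D.r_proj_psi i x)).adjoint ∘L h (proj G (D.psi i x)) ∘L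
    w.mAt (D.r_proj_psi i x)

/-- `m^{(k)}(x) = m(x) m(r̃ x) ⋯ m(r̃^{k-1} x)`. -/
noncomputable def prod : ℕ → Xt → (Cd d →L[ℂ] Cd d)
  | 0, _ => ContinuousLinearMap.id ℂ (Cd d)
  | k + 1, x => w.mat x ∘L prod k (D.rt x)

/-- The map `s ↦ m (s ∘ r)` on continuous sections. -/
noncomputable def act : Sec d E →ₗ[ℂ] Sec d E where
  toFun s := ⟨fun x => w.m x (s.1 (D.r x)), by
    have h : Continuous fun x =>
        (TotalSpace.mk' (Cd d) x (s.1 (D.r x)) : TotalSpace (Cd d) (D.r *ᵖ E)) := by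
      rw [(inducing_pullbackTotalSpaceEmbedding (Cd d) E D.r).continuous_iff]
      exact continuous_id.prodMk (s.2.comp D.continuous_r)
    exact w.continuous_m.comp h⟩
  map_add' s t := Subtype.ext (funext fun x => (w.m x).map_add _ _)
  map_smul' c s := Subtype.ext (funext fun x => (w.m x).map_smul c _)

/-- The refinement operator `M W s = (W (m (s ∘ r))) ∘ r̃⁻¹`. -/
noncomputable def refine (W : Sec d E →ₗ[ℂ] (Xt → ℂ)) : Sec d E →ₗ[ℂ] (Xt → ℂ) where
  toFun s := fun x => W (w.act s) (D.rt.symm x)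
  map_add' s t := by
    ext x
    simp
  map_smul' c s := by
    ext x
    simp

end Weight

/-- The `E(l)` condition for an endomorphism of `ℂ^d`, with the operator norm. -/
def SatisfiesE (l : ℕ) (a : Cd d →L[ℂ] Cd d) : Prop :=
  1 ≤ l ∧ l ≤ d ∧ ‖a‖ = 1 ∧
  (∀ z : ℂ, Module.End.HasEigenvalue (a : Module.End ℂ (Cd d)) z → ‖z‖ = 1 → z = 1) ∧
  Module.finrank ℂ (Module.End.eigenspace (a : Module.End ℂ (Cd d)) 1) = l ∧
  (LinearMap.charpoly (a : Module.End ℂ (Cd d))).rootMultiplicity 1 = l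

/-- The eigenspace of an endomorphism of `ℂ^d` for the eigenvalue `1`. -/
noncomputable def E1 (a : Cd d →L[ℂ] Cd d) : Submodule ℂ (Cd d) :=
  Module.End.eigenspace (a : Module.End ℂ (Cd d)) 1

end Bundle

section Xi

variable (G : Type*) {Xt : Type*} [Group G] [MetricSpace Xt] [MulAction G Xt]

/-- `⟨f₁, f₂⟩'`, lifted to `X̃`. -/
noncomputable def xiInner (f₁ f₂ : Xt → ℂ) (x : Xt) : ℂ :=
  ∑' g : G, conj (f₁ (g • x)) * f₂ (g • x)

/-- Membership in `Ξ`: `f` is bounded and continuous, and `x ↦ ∑_g |f (g x)|²` is (finite,)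
bounded and continuous. -/
def IsXi (f : Xt → ℂ) : Prop :=
  Continuous f ∧ (∃ C : ℝ, ∀ x, ‖f x‖ ≤ C) ∧
  (∀ x, Summable fun g : G => ‖f (g • x)‖ ^ 2) ∧
  Continuous (fun x => ∑' g : G, ‖f (g • x)‖ ^ 2) ∧
  ∃ C : ℝ, ∀ x, ∑' g : G, ‖f (g • x)‖ ^ 2 ≤ C

/-- Membership in `Ξ₁`. -/
def IsXi1 (f : Xt → ℂ) : Prop :=
  IsXi G f ∧ ∃ C : ℝ, 0 < C ∧
    ∀ x y, Real.sqrt (∑' g : G, ‖f (g • x) - f (g • y)‖ ^ 2) ≤ C * dist x y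

variable {G} {d : ℕ} {E : Orb G Xt → Type*}
  [∀ x, NormedAddCommGroup (E x)] [∀ x, InnerProductSpace ℂ (E x)]
  [TopologicalSpace (TotalSpace (Cd d) E)] [FiberBundle (Cd d) E] [VectorBundle ℂ (Cd d) E]

/-- Membership in `Hom(S, Ξ)`: the linear map `W` takes values in `Ξ`, is `C(X)`-linear, and has
an adjoint for the `C(X)`-valued inner products. -/
def IsHom (W : Sec d E →ₗ[ℂ] (Xt → ℂ)) : Prop :=
  (∀ s, IsXi G (W s)) ∧
  (∀ (a : C(Orb G Xt, ℂ)) (s : Sec d E) (x : Xt), W (Sec.mul a s) x = a (proj G x) * W s x) ∧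
  ∃ Wadj : (Xt → ℂ) → Sec d E, ∀ f, IsXi G f → ∀ (s : Sec d E) (x : Xt),
    xiInner G (W s) f x = inner ℂ (s.1 (proj G x)) ((Wadj f).1 (proj G x))

/-- The map `W s = ⟨s₀, s⟩ f`. -/
noncomputable def rankOne (f : Xt → ℂ) (s₀ : Sec d E) : Sec d E →ₗ[ℂ] (Xt → ℂ) where
  toFun s := fun x => inner ℂ (s₀.1 (proj G x)) (s.1 (proj G x)) * f x
  map_add' s t := by
    ext x
    simp [add_mul]
  map_smul' c s := by
    ext x
    simp [mul_assoc]

end Xi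

end Cascade

/-!
Write `a = m(x̃₀)` and `Q k x = m(r̃^{-k} x) ⋯ m(r̃⁻¹ x)` (`Weight.prodBack`).

*Convergence of the product.* In coordinates, `R 1 = 1` says that the matrices of `m` along the
inverse branches, `N_i(x) = m(ψ_i x) ∘ (change of frame by g_i)`, satisfy `∑ ‖N_i(x) u‖² = ‖u‖²`
(`Weight.sum_norm_branch_sq`); in particular all the matrices of `m` are contractions. The
condition on the eigenvalues of the contraction `a` forces `a^n` to converge to the orthogonal
projection onto `E₁` (`tendsto_pow_starProjection_E1`). As `r̃⁻¹` contracts towards `x̃₀` and `m` is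
Lipschitz, `Q (n + k) x` is within `O(θ^k)` of `a^n Q k x`, uniformly on bounded sets
(`Weight.exists_norm_prodBack_sub_le`), so the products converge uniformly on bounded sets.

*Vanishing on the orbit of `x̃₀`.* On `E₁` the first branch at `x̃₀` already preserves the norm, so
the other branches vanish; this settles `g ∉ A G`. For `g = A h` the assertion for `g` reduces to
the one for `h`, and this descent ends because otherwise nontrivial elements of `G` would move
`x̃₀` by arbitrarily small amounts (`Dilation.induction_on_ne_one`).

*The limit lies in `Hom(S, Ξ)`.* A map on sections is in `Hom(S, Ξ)` as soon as its values along
orbits are given by an equivariant, strongly continuous family of operators `B x : ℂ^d → ℓ²(G)`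
(`isHom_of_ellTwo`). For the `k`-th iterate of the refinement operator this family decomposes over
the cosets of `A G` as the sum over `i` of the family of the previous iterate at `ψ_i x` composed
with `N_i(x)` (`Weight.coef_succ`). Hence the operator norms do not increase with `k`, and the
squared Lipschitz constants satisfy a recursion `L ↦ θ L + const`, so they stay bounded on each
large ball about `x̃₀` (`Weight.sum_norm_coef_sub_sq_le`). This uses that `f` is in `Ξ₁`, that `s₀`
is in `S₁` and that the changes of frame are Lipschitz on the balls, which are compact. The bounds
on finite sums pass to the limit (`Weight.isHom_limitMap`).
-/

namespace Cascade

/-! ### Powers of a contraction of a Hermitian space -/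

section Powers

variable {d : ℕ} {a : Cd d →L[ℂ] Cd d}

theorem mem_E1 {v : Cd d} : v ∈ E1 a ↔ a v = v := by
  simp [E1]

/-- A fixed vector of a contraction is also fixed by the adjoint. -/
theorem adjoint_apply_of_mem_E1 (ha : ‖a‖ ≤ 1) {v : Cd d} (hv : v ∈ E1 a) :
    ContinuousLinearMap.adjoint a v = v := by
  have hav := mem_E1.1 hv
  have h1 : ‖ContinuousLinearMap.adjoint a v‖ ≤ ‖v‖ := by
    have := (ContinuousLinearMap.adjoint a).le_of_opNorm_le (c := 1)
      (by simpa using ha) v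
    simpa using this
  have h2 : inner ℂ (ContinuousLinearMap.adjoint a v) v = inner ℂ v v := by
    rw [ContinuousLinearMap.adjoint_inner_left, hav]
  have h3 := @norm_sub_sq ℂ _ _ _ _ (ContinuousLinearMap.adjoint a v) v
  rw [h2, inner_self_eq_norm_sq] at h3
  have h4 : ‖ContinuousLinearMap.adjoint a v - v‖ ^ 2 ≤ 0 := by
    have := pow_le_pow_left₀ (norm_nonneg _) h1 2
    linarith
  have h5 : ‖ContinuousLinearMap.adjoint a v - v‖ = 0 :=
    pow_eq_zero_iff two_ne_zero |>.1 (le_antisymm h4 (by positivity))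
  exact sub_eq_zero.1 (norm_eq_zero.1 h5)

theorem comp_starProjection_E1 : a * (E1 a).starProjection = (E1 a).starProjection := by
  ext1 v
  exact mem_E1.1 ((E1 a).starProjection_apply_mem v)

theorem starProjection_E1_comp (ha : ‖a‖ ≤ 1) :
    (E1 a).starProjection * a = (E1 a).starProjection := by
  have h : ContinuousLinearMap.adjoint a * (E1 a).starProjection = (E1 a).starProjection := by
    ext1 v
    exact adjoint_apply_of_mem_E1 ha ((E1 a).starProjection_apply_mem v)
  have h2 := congrArg star h
  rw [star_mul, (isSelfAdjoint_starProjection (E1 a)).star_eq, ← ContinuousLinearMap.star_eq_adjoint,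
    star_star] at h2
  exact h2

/-- The powers of a matrix whose eigenvalues all lie in the open unit disc tend to zero. -/
theorem tendsto_pow_of_eigenvalues_lt_one {b : Cd d →L[ℂ] Cd d}
    (hb : ∀ z : ℂ, ∀ v, v ≠ 0 → b v = z • v → ‖z‖ < 1) :
    Tendsto (fun n : ℕ => b ^ n) atTop (𝓝 0) := by
  rcases subsingleton_or_nontrivial (Cd d →L[ℂ] Cd d) with hs | hs
  · simp [Subsingleton.elim _ (0 : Cd d →L[ℂ] Cd d)]
  have hr : spectralRadius ℂ b < ((1 : ℝ≥0) : ENNReal) := by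
    refine spectrum.spectralRadius_lt_of_forall_lt b fun z hz => ?_
    have hz' : z ∈ spectrum ℂ ((b : Module.End ℂ (Cd d))) := by
      rw [spectrum.mem_iff] at hz ⊢
      refine fun h => hz ?_
      rw [Module.End.isUnit_iff] at h
      rw [ContinuousLinearMap.isUnit_iff_bijective]
      exact h
    rw [← Module.End.hasEigenvalue_iff_mem_spectrum] at hz'
    obtain ⟨v, hv⟩ := hz'.exists_hasEigenvector
    exact hb z v hv.2 hv.apply_eq_smul
  obtain ⟨c, hc1, hc2⟩ := ENNReal.lt_iff_exists_nnreal_btwn.1 hr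
  have hev := (spectrum.pow_nnnorm_pow_one_div_tendsto_nhds_spectralRadius b).eventually
    (gt_mem_nhds hc1)
  have hc2' : (c : ℝ) < 1 := by exact_mod_cast hc2
  rw [tendsto_zero_iff_norm_tendsto_zero]
  refine squeeze_zero' (Eventually.of_forall fun _ => norm_nonneg _) ?_
    (tendsto_pow_atTop_nhds_zero_of_lt_one c.2 hc2')
  filter_upwards [hev, eventually_gt_atTop 0] with n hn hn0
  have hn0' : (0 : ℝ) < n := by exact_mod_cast hn0
  have h1 := ENNReal.rpow_le_rpow hn.le hn0'.le
  rw [← ENNReal.rpow_mul, one_div, inv_mul_cancel₀ hn0'.ne', ENNReal.rpow_one,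
    ENNReal.rpow_natCast] at h1
  have h2 : ‖b ^ n‖₊ ≤ c ^ n := by exact_mod_cast h1
  exact_mod_cast h2

/-- The powers of a contraction with no eigenvalue on the unit circle other than `1` converge to
the orthogonal projection onto its fixed space. -/
theorem tendsto_pow_starProjection_E1 (ha : ‖a‖ ≤ 1)
    (hev : ∀ z : ℂ, Module.End.HasEigenvalue (a : Module.End ℂ (Cd d)) z → ‖z‖ = 1 → z = 1) :
    Tendsto (fun n : ℕ => a ^ n) atTop (𝓝 (E1 a).starProjection) := by
  set p := (E1 a).starProjection with hp
  have hap : a * p = p := comp_starProjection_E1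
  have hpa : p * a = p := starProjection_E1_comp ha
  have hpp : p * p = p := (E1 a).isIdempotentElem_starProjection
  have key : ∀ n : ℕ, a ^ (n + 1) = p + (a - p) ^ (n + 1) := by
    intro n
    induction n with
    | zero => simp
    | succ n ih =>
      have h : p * (a - p) ^ (n + 1) = 0 := by
        rw [pow_succ', ← mul_assoc, mul_sub, hpa, hpp, sub_self, zero_mul]
      rw [pow_succ', ih, pow_succ' (a - p) (n + 1), mul_add, hap, sub_mul, h, sub_zero]
  have hlim : Tendsto (fun n : ℕ => (a - p) ^ n) atTop (𝓝 0) := by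
    refine tendsto_pow_of_eigenvalues_lt_one fun z v hv hz => ?_
    by_contra! hz1
    have hz0 : z ≠ 0 := by
      rintro rfl
      norm_num at hz1
    have h0 : p * (a - p) = 0 := by rw [mul_sub, hpa, hpp, sub_self]
    have hpv : p v = 0 := by
      have h1 : p ((a - p) v) = 0 := by
        simpa using DFunLike.congr_fun h0 v
      rw [hz, map_smul] at h1
      exact (smul_eq_zero.1 h1).resolve_left hz0
    have hav : a v = z • v := by simpa [hpv] using hz
    have hz2 : ‖z‖ = 1 := by
      refine le_antisymm ?_ hz1
      have h2 := a.le_of_opNorm_le ha v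
      rw [hav, norm_smul] at h2
      exact le_of_mul_le_mul_right h2 (norm_pos_iff.2 hv)
    have hz3 := hev z (Module.End.hasEigenvalue_of_hasEigenvector
      ⟨Module.End.mem_eigenspace_iff.2 hav, hv⟩) hz2
    rw [hz3, one_smul] at hav
    exact hv (((E1 a).starProjection_eq_self_iff.2 (mem_E1.2 hav)).symm.trans hpv)
  rw [← tendsto_add_atTop_iff_nat 1]
  simp only [key]
  simpa using ((tendsto_add_atTop_iff_nat 1).2 hlim).const_add p

end Powers

/-! ### Changes of frame and the matrix of a weight -/

section Frames

set_option linter.unusedSectionVars false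

variable {G Xt : Type*} [Group G] [MetricSpace Xt] [MulAction G Xt]
  {d : ℕ} {E : Orb G Xt → Type*}
  [∀ x, NormedAddCommGroup (E x)] [∀ x, InnerProductSpace ℂ (E x)]
  [TopologicalSpace (TotalSpace (Cd d) E)] [FiberBundle (Cd d) E] [VectorBundle ℂ (Cd d) E]

namespace Frame

variable (Fr : Frame d E)

theorem at'_change {g : G} {z : Xt} {x : Orb G Xt} (h : proj G (g • z) = x) (h' : proj G z = x)
    (u : Cd d) : Fr.at' (g • z) h (Fr.change g z u) = Fr.at' z h' u := by
  subst h'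
  exact (Fr.at' (g • z) h).apply_symm_apply _

theorem at'_congr {z z' : Xt} (hz : z = z') {x : Orb G Xt} (h : proj G z = x)
    (h' : proj G z' = x) (u : Cd d) : Fr.at' z h u = Fr.at' z' h' u := by
  subst hz
  rfl

theorem mk_at' {z : Xt} {x : Orb G Xt} (h : proj G z = x) (u : Cd d) :
    (⟨proj G z, Fr.σ z u⟩ : TotalSpace (Cd d) E) = ⟨x, Fr.at' z h u⟩ := by
  subst h
  rfl

theorem mk_change (g : G) (z : Xt) (u : Cd d) :
    (⟨proj G (g • z), Fr.σ (g • z) (Fr.change g z u)⟩ : TotalSpace (Cd d) E) =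
      ⟨proj G z, Fr.σ z u⟩ := by
  rw [Fr.mk_at' (proj_smul g z), Fr.at'_change _ rfl]
  rfl

theorem at'_injective {z : Xt} {x : Orb G Xt} (h : proj G z = x) :
    Function.Injective (Fr.at' z h) := (Fr.at' z h).injective

theorem at'_lift (s : Sec d E) {z : Xt} {x : Orb G Xt} (h : proj G z = x) :
    Fr.at' z h (Fr.lift s z) = s.1 x := by
  subst h
  exact (Fr.σ z).apply_symm_apply _

theorem change_one (z : Xt) (u : Cd d) : Fr.change (1 : G) z u = u := by
  refine Fr.at'_injective (proj_smul (1 : G) z) ?_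
  rw [Fr.at'_change _ rfl, Fr.at'_congr (one_smul G z)]

/-- The cocycle identity for the changes of frame. -/
theorem change_mul (g h : G) (z : Xt) (u : Cd d) :
    Fr.change (g * h) z u = Fr.change g (h • z) (Fr.change h z u) := by
  refine Fr.at'_injective (proj_smul (g * h) z) ?_
  rw [Fr.at'_change _ rfl, Fr.at'_congr (mul_smul g h z) _ (by rw [proj_smul, proj_smul]),
    Fr.at'_change _ (proj_smul h z), Fr.at'_change _ rfl]

theorem lift_smul (s : Sec d E) (g : G) (z : Xt) :
    Fr.lift s (g • z) = Fr.change g z (Fr.lift s z) := by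
  refine Fr.at'_injective (proj_smul g z) ?_
  rw [Fr.at'_change _ rfl, Fr.at'_lift, Fr.at'_lift]

theorem inner_lift (s t : Sec d E) (z : Xt) :
    inner ℂ (Fr.lift s z) (Fr.lift t z) = inner ℂ (s.1 (proj G z)) (t.1 (proj G z)) :=
  (Fr.σ z).symm.inner_map_map _ _

theorem lift_mul (c : C(Orb G Xt, ℂ)) (s : Sec d E) (z : Xt) :
    Fr.lift (Sec.mul c s) z = c (proj G z) • Fr.lift s z :=
  (Fr.σ z).symm.map_smul _ _

theorem lift_add (s t : Sec d E) (z : Xt) : Fr.lift (s + t) z = Fr.lift s z + Fr.lift t z :=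
  (Fr.σ z).symm.map_add _ _

theorem lift_smul_left (c : ℂ) (s : Sec d E) (z : Xt) : Fr.lift (c • s) z = c • Fr.lift s z :=
  (Fr.σ z).symm.map_smul _ _

/-- The change of frame as a continuous linear map. -/
noncomputable def changeL (g : G) (z : Xt) : Cd d →L[ℂ] Cd d :=
  ((Fr.change g z).toContinuousLinearEquiv : Cd d →L[ℂ] Cd d)

theorem changeL_apply (g : G) (z : Xt) (u : Cd d) : Fr.changeL g z u = Fr.change g z u := rfl

end Frame

variable {D : Dilation G Xt} {Fr : Frame d E}

theorem mAt_at' (w : Weight D Fr) {x y : Orb G Xt} (h : D.r y = x) {z : Xt} (hz : proj G z = x)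
    (hz' : proj G z = D.r y) (u : Cd d) : w.mAt h (Fr.at' z hz u) = w.m y (Fr.at' z hz' u) := by
  subst h
  rfl

namespace Weight

variable (w : Weight D Fr)

theorem at'_mat (z : Xt) {y : Orb G Xt} (hz : proj G z = y) (hz' : proj G (D.rt z) = D.r y)
    (u : Cd d) : Fr.at' z hz (w.mat z u) = w.m y (Fr.at' (D.rt z) hz' u) := by
  subst hz
  exact (Fr.σ z).apply_symm_apply _

/-- Equivariance of the matrix of a weight under the deck group. -/
theorem mat_smul (h : G) (z : Xt) (u : Cd d) :
    w.mat (h • z) (Fr.change (D.A h) (D.rt z) u) = Fr.change h z (w.mat z u) := by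
  refine Fr.at'_injective (proj_smul h z) ?_
  have h1 : proj G (D.rt (h • z)) = D.r (proj G z) := by rw [D.proj_rt, proj_smul]
  have h2 : proj G (D.A h • D.rt z) = D.r (proj G z) := by rw [proj_smul, D.proj_rt]
  rw [Fr.at'_change _ rfl, w.at'_mat _ _ h1, w.at'_mat _ _ (D.proj_rt z),
    Fr.at'_congr (D.rt_smul h z) _ h2, Fr.at'_change _ (D.proj_rt z)]

theorem lift_act (s : Sec d E) (z : Xt) :
    Fr.lift (w.act s) z = w.mat z (Fr.lift s (D.rt z)) := by
  refine Fr.at'_injective (z := z) rfl ?_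
  rw [Fr.at'_lift, w.at'_mat _ _ (D.proj_rt z), Fr.at'_lift]
  rfl

/-- The matrix of `m` along the inverse branch `ψ i`, with source the coordinates at `z` and
target the coordinates at `ψ i z`. -/
noncomputable def branch (i : Fin D.q) (z : Xt) : Cd d →L[ℂ] Cd d :=
  w.mat (D.psi i z) ∘L Fr.changeL (D.rep i) z

theorem rt_psi (i : Fin D.q) (z : Xt) : D.rt (D.psi i z) = D.rep i • z :=
  D.rt.apply_symm_apply _

theorem at'_branch (i : Fin D.q) (z : Xt) (u : Cd d) :
    Fr.σ (D.psi i z) (w.branch i z u) = w.mAt (D.r_proj_psi i z) (Fr.σ z u) := by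
  have h2 : proj G z = D.r (proj G (D.psi i z)) := (D.r_proj_psi i z).symm
  have h1 : proj G (D.rep i • z) = D.r (proj G (D.psi i z)) := by rw [proj_smul, h2]
  have := w.at'_mat (D.psi i z) rfl (D.proj_rt _) (Fr.change (D.rep i) z u)
  rw [Fr.at'_congr (rt_psi i z) _ h1, Fr.at'_change _ h2] at this
  exact this.trans (mAt_at' w (D.r_proj_psi i z) rfl h2 u).symm

/-- The normalisation `R 1 = 1` in coordinates: the inverse branches form a column isometry. -/
theorem sum_norm_branch_sq
    (hR : ∀ x : Xt, w.transfer (fun y => ContinuousLinearMap.id ℂ (E y)) x =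
      ContinuousLinearMap.id ℂ (E (proj G x))) (z : Xt) (u : Cd d) :
    ∑ i, ‖w.branch i z u‖ ^ 2 = ‖u‖ ^ 2 := by
  have := Fr.complete
  have h1 := congrArg (fun T => (inner ℂ (Fr.σ z u) (T (Fr.σ z u)) : ℂ)) (hR z)
  simp only [transfer, sum_apply, ContinuousLinearMap.comp_apply, inner_sum,
    ContinuousLinearMap.id_apply, ContinuousLinearMap.adjoint_inner_right] at h1
  have h2 : ∀ i, (inner ℂ (w.mAt (D.r_proj_psi i z) (Fr.σ z u))
      (w.mAt (D.r_proj_psi i z) (Fr.σ z u)) : ℂ) = ((‖w.branch i z u‖ ^ 2 : ℝ) : ℂ) := by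
    intro i
    rw [← w.at'_branch, inner_self_eq_norm_sq_to_K, LinearIsometryEquiv.norm_map]
    push_cast
    rfl
  simp only [h2, inner_self_eq_norm_sq_to_K, LinearIsometryEquiv.norm_map] at h1
  refine Complex.ofReal_injective ?_
  push_cast at h1 ⊢
  exact h1

theorem norm_branch_apply_le
    (hR : ∀ x : Xt, w.transfer (fun y => ContinuousLinearMap.id ℂ (E y)) x =
      ContinuousLinearMap.id ℂ (E (proj G x))) (i : Fin D.q) (z : Xt) (u : Cd d) :
    ‖w.branch i z u‖ ≤ ‖u‖ := by
  refine le_of_sq_le_sq ?_ (norm_nonneg _)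
  rw [← w.sum_norm_branch_sq hR z u]
  exact Finset.single_le_sum (f := fun i => ‖w.branch i z u‖ ^ 2) (fun _ _ => sq_nonneg _)
    (Finset.mem_univ i)

theorem psi_first_rt (z : Xt) : D.psi ⟨0, D.q_pos⟩ (D.rt z) = z := by
  rw [Dilation.psi, D.rep_first, one_smul, Homeomorph.symm_apply_apply]

theorem branch_first_rt (z : Xt) (u : Cd d) :
    w.branch ⟨0, D.q_pos⟩ (D.rt z) u = w.mat z u := by
  rw [branch, ContinuousLinearMap.comp_apply, psi_first_rt, D.rep_first, Fr.changeL_apply,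
    Fr.change_one]

theorem norm_mat_le
    (hR : ∀ x : Xt, w.transfer (fun y => ContinuousLinearMap.id ℂ (E y)) x =
      ContinuousLinearMap.id ℂ (E (proj G x))) (z : Xt) : ‖w.mat z‖ ≤ 1 := by
  refine ContinuousLinearMap.opNorm_le_bound _ zero_le_one fun u => ?_
  rw [one_mul, ← w.branch_first_rt]
  exact w.norm_branch_apply_le hR _ _ _

theorem symm_smul (h : G) (i : Fin D.q) (z : Xt) :
    D.rt.symm ((D.A h * D.rep i) • z) = h • D.psi i z := by
  rw [Homeomorph.symm_apply_eq, D.rt_smul, rt_psi, mul_smul]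

/-- The change of frame by an element of the coset `A G g_i`, followed by `m`, factors through the
branch `ψ i`. -/
theorem mat_symm_change (h : G) (i : Fin D.q) (z : Xt) (u : Cd d) :
    w.mat (D.rt.symm ((D.A h * D.rep i) • z)) (Fr.change (D.A h * D.rep i) z u) =
      Fr.change h (D.psi i z) (w.branch i z u) := by
  rw [symm_smul, Fr.change_mul, ← rt_psi, w.mat_smul]
  rfl

end Weight

theorem Dilation.exists_coset (D : Dilation G Xt) (g : G) : ∃ h i, g = D.A h * D.rep i := by
  obtain ⟨i, ⟨h, hh⟩, -⟩ := D.rep_complete g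
  exact ⟨h, i, by rw [hh, inv_mul_cancel_right]⟩

end Frames

/-! ### The contraction `r̃⁻¹` -/

namespace Dilation

variable {G Xt : Type*} [Group G] [MetricSpace Xt] [MulAction G Xt] (D : Dilation G Xt)

theorem dist_symm_le (x y : Xt) : dist (D.rt.symm x) (D.rt.symm y) ≤ D.θ * dist x y := by
  simpa [mul_comm] using D.expansive (D.rt.symm x) (D.rt.symm y)

theorem symm_x0 : D.rt.symm D.x0 = D.x0 := by
  rw [Homeomorph.symm_apply_eq, D.rt_x0]

theorem dist_symm_iterate_le (k : ℕ) (x : Xt) :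
    dist (D.rt.symm^[k] x) D.x0 ≤ D.θ ^ k * dist x D.x0 := by
  induction k with
  | zero => simp
  | succ k ih =>
    rw [Function.iterate_succ_apply']
    calc _ = dist (D.rt.symm (D.rt.symm^[k] x)) (D.rt.symm D.x0) := by rw [D.symm_x0]
      _ ≤ D.θ * (D.θ ^ k * dist x D.x0) :=
        (D.dist_symm_le _ _).trans (mul_le_mul_of_nonneg_left ih D.θ_pos.le)
      _ = _ := by ring

theorem tendsto_pow_mul (R : ℝ) : Tendsto (fun k : ℕ => D.θ ^ k * R) atTop (𝓝 0) := by
  simpa using (tendsto_pow_atTop_nhds_zero_of_lt_one D.θ_pos.le D.θ_lt_one).mul_const R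

theorem tendsto_symm_iterate (x : Xt) : Tendsto (fun k => D.rt.symm^[k] x) atTop (𝓝 D.x0) :=
  tendsto_iff_dist_tendsto_zero.2 (squeeze_zero (fun _ => dist_nonneg)
    (fun k => D.dist_symm_iterate_le k x) (D.tendsto_pow_mul _))

theorem tendstoUniformlyOn_symm_iterate {K : Set Xt} (hK : Bornology.IsBounded K) :
    TendstoUniformlyOn (fun k => D.rt.symm^[k]) (fun _ => D.x0) atTop K := by
  obtain ⟨R, hR⟩ := (Metric.isBounded_iff_subset_closedBall D.x0).1 hK
  rw [Metric.tendstoUniformlyOn_iff]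
  intro ε hε
  filter_upwards [(D.tendsto_pow_mul R).eventually (gt_mem_nhds hε)] with k hk x hx
  rw [dist_comm]
  exact ((D.dist_symm_iterate_le k x).trans (mul_le_mul_of_nonneg_left
    (Metric.mem_closedBall.1 (hR hx)) (pow_nonneg D.θ_pos.le k))).trans_lt hk

/-- Closed balls about the fixed point are compact: a power of the contraction `r̃⁻¹` maps them
into a compact neighbourhood of the fixed point. -/
theorem isCompact_closedBall [LocallyCompactSpace Xt] (R : ℝ) :
    IsCompact (Metric.closedBall D.x0 R) := by
  obtain ⟨K, hK, hKn⟩ := exists_compact_mem_nhds D.x0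
  obtain ⟨ε, hε, hball⟩ := Metric.mem_nhds_iff.1 hKn
  obtain ⟨k, hk⟩ := (Metric.tendstoUniformlyOn_iff.1 (D.tendstoUniformlyOn_symm_iterate
    (Metric.isBounded_closedBall (x := D.x0) (r := R))) ε hε).exists
  refine (hK.image (D.rt.continuous.iterate k)).of_isClosed_subset Metric.isClosed_closedBall
    fun x hx => ⟨D.rt.symm^[k] x, hball ?_, ?_⟩
  · rw [Metric.mem_ball, dist_comm]
    exact hk x hx
  · exact (Function.LeftInverse.iterate D.rt.apply_symm_apply k) x

theorem dist_psi_le [IsIsometricSMul G Xt] (i : Fin D.q) (x y : Xt) :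
    dist (D.psi i x) (D.psi i y) ≤ D.θ * dist x y := by
  simpa [psi] using D.dist_symm_le (D.rep i • x) (D.rep i • y)

/-- All sufficiently large balls about the fixed point are invariant under the inverse branches. -/
theorem exists_invariant_radius [IsIsometricSMul G Xt] : ∃ R₀ : ℝ, ∀ R ≥ R₀, ∀ i,
    ∀ x ∈ Metric.closedBall D.x0 R, D.psi i x ∈ Metric.closedBall D.x0 R := by
  set c := ∑ i, dist (D.psi i D.x0) D.x0 with hc
  have h1 : 0 < 1 - D.θ := sub_pos.2 D.θ_lt_one
  refine ⟨c / (1 - D.θ), fun R hR i x hx => ?_⟩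
  rw [Metric.mem_closedBall] at hx ⊢
  have h2 : dist (D.psi i D.x0) D.x0 ≤ c :=
    Finset.single_le_sum (f := fun i => dist (D.psi i D.x0) D.x0) (fun _ _ => dist_nonneg)
      (Finset.mem_univ i)
  have h3 : c ≤ R * (1 - D.θ) := (div_le_iff₀ h1).1 hR
  have h4 := dist_triangle (D.psi i x) (D.psi i D.x0) D.x0
  have h5 := (D.dist_psi_le i x D.x0).trans (mul_le_mul_of_nonneg_left hx D.θ_pos.le)
  linarith

end Dilation

/-! ### Convergence of the infinite product -/

section Product

set_option linter.unusedSectionVars false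

variable {G Xt : Type*} [Group G] [MetricSpace Xt] [MulAction G Xt]
  {d : ℕ} {E : Orb G Xt → Type*}
  [∀ x, NormedAddCommGroup (E x)] [∀ x, InnerProductSpace ℂ (E x)]
  [TopologicalSpace (TotalSpace (Cd d) E)] [FiberBundle (Cd d) E] [VectorBundle ℂ (Cd d) E]
  {D : Dilation G Xt} {Fr : Frame d E}

namespace Weight

variable (w : Weight D Fr)

/-- The product `m^{(k)}(r̃^{-k} x) = m(r̃^{-k} x) ⋯ m(r̃⁻¹ x)`. -/
noncomputable def prodBack (k : ℕ) (x : Xt) : Cd d →L[ℂ] Cd d := w.prod k (D.rt.symm^[k] x)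

theorem prodBack_zero (x : Xt) : w.prodBack 0 x = ContinuousLinearMap.id ℂ (Cd d) := rfl

theorem prodBack_succ (k : ℕ) (x : Xt) :
    w.prodBack (k + 1) x = w.mat (D.rt.symm^[k + 1] x) ∘L w.prodBack k x := by
  rw [prodBack, prod, Function.iterate_succ_apply', Homeomorph.apply_symm_apply]
  rfl

theorem prodBack_succ' (k : ℕ) (x : Xt) :
    w.prodBack (k + 1) x = w.prodBack k (D.rt.symm x) ∘L w.mat (D.rt.symm x) := by
  induction k with
  | zero => rfl
  | succ k ih =>
    rw [prodBack_succ, ih, ← ContinuousLinearMap.comp_assoc, Function.iterate_succ_apply,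
      ← prodBack_succ]

theorem prodBack_x0 (k : ℕ) : w.prodBack k D.x0 = w.mat D.x0 ^ k := by
  induction k with
  | zero => rfl
  | succ k ih =>
    rw [prodBack_succ', D.symm_x0, ih, pow_succ]
    rfl

variable (hm : ∀ x, ‖w.mat x‖ ≤ 1)
include hm

theorem norm_prodBack_le (k : ℕ) (x : Xt) : ‖w.prodBack k x‖ ≤ 1 := by
  induction k with
  | zero => exact ContinuousLinearMap.norm_id_le
  | succ k ih =>
    rw [prodBack_succ]
    exact (ContinuousLinearMap.opNorm_comp_le _ _).trans
      (mul_le_one₀ (hm _) (norm_nonneg _) ih)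

/-- Beyond the first `k` factors the product is close to a power of the matrix at the fixed
point, by the Lipschitz property and the geometric convergence `r̃^{-j} x → x̃₀`. -/
theorem exists_norm_prodBack_sub_le (R : ℝ) : ∃ C : ℝ, ∀ x ∈ Metric.closedBall D.x0 R, ∀ k n,
    ‖w.prodBack (n + k) x - w.mat D.x0 ^ n * w.prodBack k x‖ ≤ D.θ ^ k * C := by
  obtain ⟨K, hK⟩ := w.lipschitz_m
  have h1 : 0 < 1 - D.θ := sub_pos.2 D.θ_lt_one
  have hθ := D.θ_pos
  refine ⟨K * R * D.θ / (1 - D.θ), fun x hx k n => ?_⟩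
  have hx' := Metric.mem_closedBall.1 hx
  have hR : 0 ≤ R := dist_nonneg.trans hx'
  set C := K * R * D.θ / (1 - D.θ) with hC
  have hC0 : 0 ≤ C := by positivity
  have hC1 : C * (1 - D.θ) = K * R * D.θ := by rw [hC]; field_simp
  suffices h : ‖w.prodBack (n + k) x - w.mat D.x0 ^ n * w.prodBack k x‖ ≤
      D.θ ^ k * C * (1 - D.θ ^ n) by
    refine h.trans (mul_le_of_le_one_right (by positivity) ?_)
    have := pow_pos hθ n
    linarith
  induction n with
  | zero => simp
  | succ n ih =>
    set y := D.rt.symm^[n + k + 1] x with hy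
    have h2 : ‖w.mat y - w.mat D.x0‖ ≤ K * (D.θ ^ (n + k + 1) * R) := by
      rw [← dist_eq_norm]
      refine (hK.dist_le_mul y D.x0).trans (mul_le_mul_of_nonneg_left ?_ K.2)
      exact (D.dist_symm_iterate_le _ x).trans
        (mul_le_mul_of_nonneg_left hx' (pow_nonneg hθ.le _))
    have h3 : w.prodBack (n + 1 + k) x - w.mat D.x0 ^ (n + 1) * w.prodBack k x =
        (w.mat y - w.mat D.x0) * w.prodBack (n + k) x +
          w.mat D.x0 * (w.prodBack (n + k) x - w.mat D.x0 ^ n * w.prodBack k x) := by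
      have h4 : w.prodBack (n + 1 + k) x = w.mat y * w.prodBack (n + k) x := by
        rw [add_right_comm, prodBack_succ]
        rfl
      rw [h4, pow_succ', sub_mul, mul_sub, mul_assoc, sub_add_sub_cancel]
    have h5 : ‖(w.mat y - w.mat D.x0) * w.prodBack (n + k) x‖ ≤ K * (D.θ ^ (n + k + 1) * R) := by
      refine (norm_mul_le _ _).trans ((mul_le_of_le_one_right (norm_nonneg _) ?_).trans h2)
      exact w.norm_prodBack_le hm _ _
    have h6 : ‖w.mat D.x0 * (w.prodBack (n + k) x - w.mat D.x0 ^ n * w.prodBack k x)‖ ≤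
        D.θ ^ k * C * (1 - D.θ ^ n) :=
      (norm_mul_le _ _).trans ((mul_le_of_le_one_left (norm_nonneg _) (hm _)).trans ih)
    rw [h3]
    refine (norm_add_le _ _).trans ((add_le_add h5 h6).trans (le_of_eq ?_))
    have h7 : (K : ℝ) * (D.θ ^ (n + k + 1) * R) = D.θ ^ k * D.θ ^ n * (C * (1 - D.θ)) := by
      rw [hC1]; ring
    rw [h7]
    ring

theorem exists_tendstoUniformlyOn_prodBack
    (hev : ∀ z : ℂ, Module.End.HasEigenvalue (w.mat D.x0 : Module.End ℂ (Cd d)) z →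
      ‖z‖ = 1 → z = 1) :
    ∃ P : Xt → (Cd d →L[ℂ] Cd d), ∀ K : Set Xt, Bornology.IsBounded K →
      TendstoUniformlyOn w.prodBack P atTop K := by
  have hpow := (tendsto_pow_starProjection_E1 (hm D.x0) hev).cauchySeq
  have key : ∀ R, UniformCauchySeqOn w.prodBack atTop (Metric.closedBall D.x0 R) := by
    intro R
    obtain ⟨C, hC⟩ := w.exists_norm_prodBack_sub_le hm R
    rw [Metric.uniformCauchySeqOn_iff]
    intro ε hε
    obtain ⟨k, hk⟩ := ((D.tendsto_pow_mul C).eventually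
      (gt_mem_nhds (by positivity : 0 < ε / 3))).exists
    obtain ⟨N, hN⟩ := Metric.cauchySeq_iff.1 hpow (ε / 3) (by positivity)
    refine ⟨N + k, fun m hmN n hnN x hx => ?_⟩
    obtain ⟨m, rfl⟩ := Nat.exists_eq_add_of_le' ((Nat.le_add_left k N).trans hmN)
    obtain ⟨n, rfl⟩ := Nat.exists_eq_add_of_le' ((Nat.le_add_left k N).trans hnN)
    have h1 := (hC x hx k m).trans_lt hk
    have h2 := (hC x hx k n).trans_lt hk
    have h3 : ‖w.mat D.x0 ^ m * w.prodBack k x - w.mat D.x0 ^ n * w.prodBack k x‖ < ε / 3 := by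
      rw [← sub_mul]
      refine (norm_mul_le _ _).trans_lt ((mul_le_of_le_one_right (norm_nonneg _)
        (w.norm_prodBack_le hm _ _)).trans_lt ?_)
      rw [← dist_eq_norm]
      exact hN m (by omega) n (by omega)
    rw [← dist_eq_norm] at h1 h2 h3
    rw [dist_comm] at h2
    calc _ ≤ _ := dist_triangle4 _ _ _ _
      _ < ε / 3 + ε / 3 + ε / 3 := add_lt_add (add_lt_add h1 h3) h2
      _ = ε := by ring
  have hlim : ∀ x, ∃ p, Tendsto (fun k => w.prodBack k x) atTop (𝓝 p) := fun x =>
    cauchySeq_tendsto_of_complete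
      ((key (dist x D.x0)).cauchySeq (Metric.mem_closedBall.2 le_rfl))
  choose P hP using hlim
  refine ⟨P, fun K hK => ?_⟩
  obtain ⟨R, hR⟩ := (Metric.isBounded_iff_subset_closedBall D.x0).1 hK
  exact ((key R).tendstoUniformlyOn_of_tendsto fun x _ => hP x).mono hR

end Weight

end Product

section Kernel

set_option linter.unusedSectionVars false

variable {G Xt : Type*} [Group G] [MetricSpace Xt] [MulAction G Xt]
  {d : ℕ} {E : Orb G Xt → Type*}
  [∀ x, NormedAddCommGroup (E x)] [∀ x, InnerProductSpace ℂ (E x)]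
  [TopologicalSpace (TotalSpace (Cd d) E)] [FiberBundle (Cd d) E] [VectorBundle ℂ (Cd d) E]
  {D : Dilation G Xt} {Fr : Frame d E}

/-- A group element other than `1` is not infinitely divisible under `A`: it can be written as
`A^n g'` with `g'` in a nontrivial coset of the image of `A`. -/
theorem Dilation.induction_on_ne_one [IsIsometricSMul G Xt] (D : Dilation G Xt) {p : G → Prop}
    (hcoset : ∀ h i, i ≠ ⟨0, D.q_pos⟩ → p (D.A h * D.rep i))
    (hA : ∀ h, h ≠ 1 → p h → p (D.A h)) {g : G} (hg : g ≠ 1) : p g := by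
  by_contra hp
  have hstep : ∀ g : G, g ≠ 1 ∧ ¬ p g → ∃ h : G, (h ≠ 1 ∧ ¬ p h) ∧ g = D.A h := by
    rintro g ⟨hg, hp⟩
    obtain ⟨h, i, rfl⟩ := D.exists_coset g
    have hi : i = ⟨0, D.q_pos⟩ := by
      by_contra hi
      exact hp (hcoset h i hi)
    rw [hi, D.rep_first, mul_one] at hp hg ⊢
    have hh : h ≠ 1 := by
      rintro rfl
      exact hg (map_one _)
    exact ⟨h, ⟨hh, fun h' => hp (hA h hh h')⟩, rfl⟩
  choose! F hF1 hF2 using hstep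
  have hq : ∀ k, F^[k] g ≠ 1 ∧ ¬ p (F^[k] g) := by
    intro k
    induction k with
    | zero => exact ⟨hg, hp⟩
    | succ k ih =>
      rw [Function.iterate_succ_apply']
      exact hF1 _ ih
  have horb : ∀ k, F^[k] g • D.x0 = D.rt.symm^[k] (g • D.x0) := by
    intro k
    induction k with
    | zero => rfl
    | succ k ih =>
      rw [Function.iterate_succ_apply', Function.iterate_succ_apply', ← ih, eq_comm,
        Homeomorph.symm_apply_eq, D.rt_smul, ← hF2 _ (hq k), D.rt_x0]
  -- The elements `F^[k] g ≠ 1` move the fixed point by less and less, which a covering action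
  -- does not allow.
  obtain ⟨U, hU, hdisj⟩ := D.covering.disjoint D.x0
  have hlim := D.tendsto_symm_iterate (g • D.x0)
  obtain ⟨k, hk⟩ := (hlim.eventually hU).exists
  rw [← horb] at hk
  exact (hq k).1 (hdisj _ ⟨_, ⟨D.x0, mem_of_mem_nhds hU, rfl⟩, hk⟩)

/-- The normalisation at the fixed point leaves nothing for the branches other than the first on
the fixed space. -/
theorem Weight.branch_x0_eq_zero (w : Weight D Fr)
    (hR : ∀ x : Xt, w.transfer (fun y => ContinuousLinearMap.id ℂ (E y)) x =
      ContinuousLinearMap.id ℂ (E (proj G x))) {v : Cd d} (hv : v ∈ E1 (w.mat D.x0))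
    {i : Fin D.q} (hi : i ≠ ⟨0, D.q_pos⟩) : w.branch i D.x0 v = 0 := by
  have h1 := w.sum_norm_branch_sq hR D.x0 v
  have h2 : w.branch ⟨0, D.q_pos⟩ D.x0 v = v := by
    have := w.branch_first_rt D.x0 v
    rwa [D.rt_x0, mem_E1.1 hv] at this
  rw [← Finset.add_sum_erase _ _ (Finset.mem_univ (⟨0, D.q_pos⟩ : Fin D.q)), h2,
    add_eq_left, Finset.sum_eq_zero_iff_of_nonneg fun _ _ => sq_nonneg _] at h1
  simpa using h1 i (by simp [hi])

theorem Weight.apply_change_x0_eq_zero [IsIsometricSMul G Xt] (w : Weight D Fr)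
    (hR : ∀ x : Xt, w.transfer (fun y => ContinuousLinearMap.id ℂ (E y)) x =
      ContinuousLinearMap.id ℂ (E (proj G x))) {P : Xt → (Cd d →L[ℂ] Cd d)}
    (hP : ∀ x, P (D.rt.symm x) ∘L w.mat (D.rt.symm x) = P x) {g : G} (hg : g ≠ 1) {v : Cd d}
    (hv : v ∈ E1 (w.mat D.x0)) : P (g • D.x0) (Fr.change g D.x0 v) = 0 := by
  refine D.induction_on_ne_one (p := fun g => P (g • D.x0) (Fr.change g D.x0 v) = 0) ?_ ?_ hg
  · intro h i hi
    rw [← hP, ContinuousLinearMap.comp_apply, w.mat_symm_change, w.branch_x0_eq_zero hR hv hi,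
      map_zero, map_zero]
  · intro h _ hh
    have h1 : D.rt.symm (D.A h • D.x0) = h • D.x0 := by
      rw [Homeomorph.symm_apply_eq, D.rt_smul, D.rt_x0]
    have h2 := w.mat_smul h D.x0 v
    rw [D.rt_x0, mem_E1.1 hv] at h2
    rw [← hP, ContinuousLinearMap.comp_apply, h1, h2, hh]

end Kernel

/-! ### Local coordinates of a frame -/

section Coordinates

set_option linter.unusedSectionVars false

variable {G Xt : Type*} [Group G] [MetricSpace Xt] [MulAction G Xt]
  {d : ℕ} {E : Orb G Xt → Type*}
  [∀ x, NormedAddCommGroup (E x)] [∀ x, InnerProductSpace ℂ (E x)]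
  [TopologicalSpace (TotalSpace (Cd d) E)] [FiberBundle (Cd d) E] [VectorBundle ℂ (Cd d) E]

theorem continuous_proj : Continuous (proj G : Xt → Orb G Xt) := continuous_quotient_mk'

namespace Frame

variable (Fr : Frame d E)

/-- Near any point, the frame is given in a local trivialisation by a Lipschitz family of
invertible matrices. -/
theorem exists_coord (z : Xt) : ∃ (e : Trivialization (Cd d) (π (Cd d) E))
    (A : Xt → (Cd d →L[ℂ] Cd d)) (K : ℝ), 0 ≤ K ∧ proj G z ∈ e.baseSet ∧
    (∀ x, proj G x ∈ e.baseSet → ∀ v, A x v = (e ⟨proj G x, Fr.σ x v⟩).2) ∧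
    (∀ x, proj G x ∈ e.baseSet → IsUnit (A x)) ∧
    ∀ x y, proj G x ∈ e.baseSet → proj G y ∈ e.baseSet → ‖A x - A y‖ ≤ K * dist x y := by
  obtain ⟨𝒜, hlin, hcov, -, hlip⟩ := Fr.lipschitz
  obtain ⟨e, he, hz⟩ := hcov (proj G z)
  have := hlin e he
  obtain ⟨K, hK⟩ := hlip e he
  have hA : ∀ x, proj G x ∈ e.baseSet → ∀ v,
      (e.linearMapAt ℂ (proj G x)) (Fr.σ x v) = (e ⟨proj G x, Fr.σ x v⟩).2 := fun x hx v => by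
    rw [Trivialization.coe_linearMapAt_of_mem e hx]
  refine ⟨e, fun x => LinearMap.toContinuousLinearMap
    ((e.linearMapAt ℂ (proj G x)) ∘ₗ (Fr.σ x).toLinearEquiv.toLinearMap), max K 0,
    le_max_right _ _, hz, hA, fun x hx => ?_, fun x y hx hy => ?_⟩
  · rw [ContinuousLinearMap.isUnit_iff_bijective]
    have h := (e.linearEquivAt ℂ (proj G x) hx).bijective.comp (Fr.σ x).bijective
    convert h using 1
    ext v
    simp [hA x hx]
  · refine ContinuousLinearMap.opNorm_le_bound _ (by positivity) fun v => ?_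
    refine (le_of_eq ?_).trans ((hK x y hx hy v).trans ?_)
    · rw [← hA x hx, ← hA y hy]
      rfl
    · gcongr
      exact le_max_left _ _

theorem continuous_lift (s : Sec d E) : Continuous (Fr.lift s) := by
  refine continuous_iff_continuousAt.2 fun z => ?_
  obtain ⟨e, A, K, hK, hz, hA, hu, hlip⟩ := Fr.exists_coord z
  have hev : ∀ᶠ x in 𝓝 z, proj G x ∈ e.baseSet :=
    continuous_proj.continuousAt (e.open_baseSet.mem_nhds hz)
  have hAc : ContinuousAt A z := by
    rw [ContinuousAt, tendsto_iff_norm_sub_tendsto_zero]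
    refine squeeze_zero' (g := fun x => K * dist x z) (Eventually.of_forall fun _ => norm_nonneg _)
      (hev.mono fun x hx => hlip x z hx hz) ?_
    simpa using ((continuous_id.dist (continuous_const (y := z))).tendsto z).const_mul K
  have hinv : ContinuousAt (fun x => Ring.inverse (A x)) z := by
    obtain ⟨B, hB⟩ := hu z hz
    exact ContinuousAt.comp (by rw [← hB]; exact NormedRing.inverse_continuousAt B) hAc
  have hs : ContinuousAt (fun x => (e ⟨proj G x, s.1 (proj G x)⟩).2) z := by
    have h1 : ContinuousAt (fun x : Xt => e (⟨proj G x, s.1 (proj G x)⟩ : TotalSpace (Cd d) E)) z :=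
      ContinuousAt.comp (e.toOpenPartialHomeomorph.continuousAt (e.mem_source.2 hz))
        (s.2.comp continuous_proj).continuousAt
    exact h1.snd
  refine (hinv.clm_apply hs).congr (hev.mono fun x hx => ?_)
  have h1 : (e ⟨proj G x, s.1 (proj G x)⟩).2 = A x (Fr.lift s x) := by
    rw [hA x hx, lift, LinearIsometryEquiv.apply_symm_apply]
  have h2 := DFunLike.congr_fun (Ring.inverse_mul_cancel _ (hu x hx)) (Fr.lift s x)
  simp only [h1]
  exact h2

theorem locallyLipschitz_changeL [IsIsometricSMul G Xt] (g : G) :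
    LocallyLipschitz (Fr.changeL g) := by
  intro z
  obtain ⟨e, A, K, hK, hz, hA, hu, hlip⟩ := Fr.exists_coord z
  have hev : ∀ᶠ x in 𝓝 z, proj G x ∈ e.baseSet :=
    continuous_proj.continuousAt (e.open_baseSet.mem_nhds hz)
  have hbase : ∀ x : Xt, proj G x ∈ e.baseSet → proj G (g • x) ∈ e.baseSet := fun x hx => by
    rwa [proj_smul]
  have hAc : ContinuousAt (fun x => A (g • x)) z := by
    rw [ContinuousAt, tendsto_iff_norm_sub_tendsto_zero]
    refine squeeze_zero' (g := fun x => K * dist x z) (Eventually.of_forall fun _ => norm_nonneg _)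
      (hev.mono fun x hx => ?_) ?_
    · have := hlip (g • x) (g • z) (hbase x hx) (hbase z hz)
      rwa [dist_smul] at this
    · simpa using ((continuous_id.dist (continuous_const (y := z))).tendsto z).const_mul K
  have hinv : ContinuousAt (fun x => Ring.inverse (A (g • x))) z := by
    obtain ⟨B, hB⟩ := hu _ (hbase z hz)
    exact ContinuousAt.comp (f := fun x => A (g • x))
      (by rw [← hB]; exact NormedRing.inverse_continuousAt B) hAc
  have hcomp : ∀ x, proj G x ∈ e.baseSet → A (g • x) * Fr.changeL g x = A x := fun x hx => by
    ext1 v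
    rw [mul_apply_eq_comp, changeL_apply, hA _ (hbase x hx), hA _ hx, mk_change]
  set M := ‖Ring.inverse (A (g • z))‖ + 1 with hM
  have hM0 : 0 ≤ M := by positivity
  have hnb : ∀ᶠ x in 𝓝 z, ‖Ring.inverse (A (g • x))‖ ≤ M :=
    (hinv.norm.eventually (gt_mem_nhds (lt_add_one _))).mono fun x hx => hx.le
  have hch : ∀ x, ‖Fr.changeL g x‖ ≤ 1 := fun x =>
    ContinuousLinearMap.opNorm_le_bound _ zero_le_one fun v => by
      rw [one_mul, changeL_apply, LinearIsometryEquiv.norm_map]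
  refine ⟨(M * (2 * K)).toNNReal, _, hev.and hnb, ?_⟩
  refine LipschitzOnWith.of_dist_le_mul fun x hx y hy => ?_
  rw [Real.coe_toNNReal _ (by positivity), dist_eq_norm]
  have h1 : Fr.changeL g x - Fr.changeL g y = Ring.inverse (A (g • x)) *
      ((A x - A y) + (A (g • y) - A (g • x)) * Fr.changeL g y) := by
    rw [sub_mul, hcomp y hy.1, sub_add_sub_cancel, ← hcomp x hx.1, ← mul_sub, ← mul_assoc,
      Ring.inverse_mul_cancel _ (hu _ (hbase x hx.1)), one_mul]
  have h2 := hlip x y hx.1 hy.1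
  have h3 : ‖A (g • y) - A (g • x)‖ ≤ K * dist x y := by
    have := hlip (g • y) (g • x) (hbase y hy.1) (hbase x hx.1)
    rwa [dist_smul, dist_comm] at this
  have h4 : ‖(A (g • y) - A (g • x)) * Fr.changeL g y‖ ≤ K * dist x y :=
    (norm_mul_le _ _).trans ((mul_le_of_le_one_right (norm_nonneg _) (hch y)).trans h3)
  rw [h1]
  calc _ ≤ M * (K * dist x y + K * dist x y) :=
        (norm_mul_le _ _).trans (mul_le_mul hx.2 ((norm_add_le _ _).trans (add_le_add h2 h4))
          (norm_nonneg _) hM0)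
    _ = _ := by ring

/-- A continuous equivariant function is the lift of a continuous section. -/
theorem exists_section {V : Xt → Cd d} (hV : Continuous V)
    (hequi : ∀ g x, V (g • x) = Fr.change g x (V x)) : ∃ t : Sec d E, ∀ x, Fr.lift t x = V x := by
  have key : ∀ x z : Xt, ∀ h : proj G z = proj G x, Fr.at' z h (V z) = Fr.σ x (V x) := by
    intro x z h
    obtain ⟨g, hg⟩ := Quotient.exact h
    dsimp only at hg
    subst hg
    rw [hequi, Fr.at'_change _ rfl]
    rfl
  have hval : ∀ x : Xt, Fr.at' (proj G x).out (Quotient.out_eq _) (V (proj G x).out) =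
      Fr.σ x (V x) := fun x => key x _ _
  refine ⟨⟨fun y => Fr.at' y.out (Quotient.out_eq y) (V y.out), ?_⟩, fun x => ?_⟩
  · refine (isQuotientMap_quotient_mk' (s := MulAction.orbitRel G Xt)).continuous_iff.2 ?_
    have h1 := Fr.continuous_σ.comp (continuous_id.prodMk hV)
    refine h1.congr fun x => ?_
    exact congrArg (fun v => (⟨proj G x, v⟩ : TotalSpace (Cd d) E)) (hval x).symm
  · rw [lift, LinearIsometryEquiv.symm_apply_eq]
    exact hval x

end Frame

theorem exists_bound_of_invariant [CompactSpace (Orb G Xt)] {φ : Xt → ℝ} (hφ : Continuous φ)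
    (hinv : ∀ (g : G) x, φ (g • x) = φ x) : ∃ C, ∀ x, φ x ≤ C := by
  have h : ∀ a b : Xt, MulAction.orbitRel G Xt a b → φ a = φ b := by
    rintro _ b ⟨g, rfl⟩
    exact hinv g b
  have hc : Continuous (Quotient.lift φ h : Orb G Xt → ℝ) := hφ.quotient_lift h
  obtain ⟨C, hC⟩ := (isCompact_range hc).bddAbove
  exact ⟨C, fun x => hC ⟨proj G x, rfl⟩⟩

end Coordinates

/-! ### Square-summable families -/

section SquareSummable

/-- The Hilbert space `ℓ²(G)`. -/
abbrev EllTwo (G : Type*) : Type _ := lp (fun _ : G => ℂ) 2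

variable {G : Type*}

theorem memℓp_two {a : G → ℂ} (ha : Summable fun g => ‖a g‖ ^ 2) : Memℓp a 2 :=
  memℓp_gen (by simpa using ha)

theorem EllTwo.hasSum_norm_sq (a : EllTwo G) : HasSum (fun g => ‖a g‖ ^ 2) (‖a‖ ^ 2) := by
  have := lp.hasSum_norm (p := 2) (by norm_num) a
  simpa using this

/-- In `ℓ²`, continuity of the coordinates and of the norm imply continuity. -/
theorem EllTwo.continuous_of_coord {X : Type*} [TopologicalSpace X] {a : X → EllTwo G}
    (hcoord : ∀ g, Continuous fun x => a x g) (hnorm : Continuous fun x => ‖a x‖ ^ 2) :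
    Continuous a := by
  classical
  refine continuous_iff_continuousAt.2 fun x => ?_
  have hbdd : ∀ᶠ y in 𝓝 x, ‖a y‖ < ‖a x‖ + 1 := by
    have h1 : Continuous fun y => ‖a y‖ := by
      simpa [Real.sqrt_sq] using hnorm.sqrt
    exact h1.continuousAt.eventually (gt_mem_nhds (lt_add_one _))
  -- Finitely supported approximations of `a x` give weak continuity at `x`.
  have hweak : ContinuousAt (fun y => (inner ℂ (a x) (a y) : ℂ)) x := by
    refine continuousAt_of_locally_uniform_approx_of_continuousAt fun u hu => ?_
    obtain ⟨ε, hε, hεu⟩ := Metric.mem_uniformity_dist.1 hu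
    obtain ⟨F, hF⟩ := ((lp.hasSum_single (p := 2) ENNReal.ofNat_ne_top (a x)).eventually
      (Metric.ball_mem_nhds _ (show 0 < ε / (‖a x‖ + 1) by positivity))).exists
    refine ⟨_, hbdd, fun y => inner ℂ (∑ g ∈ F, lp.single 2 g (a x g)) (a y), ?_, fun y hy => ?_⟩
    · have h2 : Continuous fun y => (∑ g ∈ F, inner ℂ (a x g) (a y g) : ℂ) :=
        continuous_finsetSum _ fun g _ => continuous_const.inner (hcoord g)
      refine h2.continuousAt.congr (Eventually.of_forall fun y => ?_)
      simp only [sum_inner, lp.inner_single_left]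
    · refine hεu ?_
      rw [dist_comm, dist_eq_norm] at hF
      rw [dist_eq_norm, ← inner_sub_left]
      calc _ ≤ _ := norm_inner_le_norm _ _
        _ < ε / (‖a x‖ + 1) * (‖a x‖ + 1) :=
          mul_lt_mul'' hF hy (norm_nonneg _) (norm_nonneg _)
        _ = ε := by field_simp
  have h3 : Tendsto (fun y => ‖a y - a x‖ ^ 2) (𝓝 x) (𝓝 0) := by
    have h4 : ∀ y, ‖a y - a x‖ ^ 2 =
        ‖a x‖ ^ 2 - 2 * (inner ℂ (a x) (a y) : ℂ).re + ‖a y‖ ^ 2 := fun y => by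
      rw [norm_sub_rev, @norm_sub_sq ℂ]
      rfl
    have h5 : Tendsto (fun y => (inner ℂ (a x) (a y) : ℂ).re) (𝓝 x) (𝓝 (‖a x‖ ^ 2)) := by
      have h7 : (inner ℂ (a x) (a x) : ℂ).re = ‖a x‖ ^ 2 := inner_self_eq_norm_sq (𝕜 := ℂ) (a x)
      rw [← h7]
      exact (Complex.continuous_re.tendsto _).comp hweak
    simp only [h4]
    have h6 := ((h5.const_mul 2).const_sub (‖a x‖ ^ 2)).add (hnorm.tendsto x)
    rwa [show ‖a x‖ ^ 2 - 2 * ‖a x‖ ^ 2 + ‖a x‖ ^ 2 = 0 by ring] at h6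
  rw [ContinuousAt, tendsto_iff_norm_sub_tendsto_zero]
  simpa [Real.sqrt_sq] using h3.sqrt

end SquareSummable

/-! ### A criterion for membership in `Hom(S, Ξ)` -/

section Hom

set_option linter.unusedSectionVars false

variable {G Xt : Type*} [Group G] [MetricSpace Xt] [MulAction G Xt]
  {d : ℕ} {E : Orb G Xt → Type*}
  [∀ x, NormedAddCommGroup (E x)] [∀ x, InnerProductSpace ℂ (E x)]
  [TopologicalSpace (TotalSpace (Cd d) E)] [FiberBundle (Cd d) E] [VectorBundle ℂ (Cd d) E]

/-- The family `(f (g x))_g` of values of `f ∈ Ξ` along an orbit. -/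
noncomputable def IsXi.orbit {f : Xt → ℂ} (hf : IsXi G f) (x : Xt) : EllTwo G :=
  ⟨fun g => f (g • x), memℓp_two (hf.2.2.1 x)⟩

theorem IsXi.orbit_apply {f : Xt → ℂ} (hf : IsXi G f) (x : Xt) (g : G) :
    hf.orbit x g = f (g • x) := rfl

theorem IsXi.continuous_orbit [IsIsometricSMul G Xt] {f : Xt → ℂ} (hf : IsXi G f) :
    Continuous hf.orbit := by
  refine EllTwo.continuous_of_coord (fun g => hf.1.comp (continuous_const_smul g)) ?_
  refine hf.2.2.2.1.congr fun x => ?_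
  exact (EllTwo.hasSum_norm_sq (hf.orbit x)).tsum_eq

/-- A linear map on sections given by an equivariant, strongly continuous family of operators
`B x : ℂ^d → ℓ²(G)` belongs to `Hom(S, Ξ)`; its adjoint is given by the adjoints of the `B x`. -/
theorem isHom_of_ellTwo [IsIsometricSMul G Xt] [CompactSpace (Orb G Xt)] (Fr : Frame d E)
    (W : Sec d E →ₗ[ℂ] (Xt → ℂ)) (B : Xt → (Cd d →L[ℂ] EllTwo G))
    (hB : ∀ u, Continuous fun x => B x u)
    (hequi : ∀ h x u g, B (h • x) (Fr.change h x u) g = B x u (g * h))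
    (hW : ∀ s x, W s x = B x (Fr.lift s x) 1) : IsHom W := by
  have hBc : Continuous B := continuous_clm_apply.2 hB
  have hWg : ∀ s (g : G) x, W s (g • x) = B x (Fr.lift s x) g := fun s g x => by
    rw [hW, Fr.lift_smul, hequi, one_mul]
  have hb : ∀ s, Continuous fun x => B x (Fr.lift s x) := fun s =>
    hBc.clm_apply (Fr.continuous_lift s)
  have hsum : ∀ s x, HasSum (fun g : G => ‖W s (g • x)‖ ^ 2) (‖B x (Fr.lift s x)‖ ^ 2) :=
    fun s x => by
      simp only [hWg]
      exact EllTwo.hasSum_norm_sq _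
  have hinv : ∀ s (h : G) x, ‖B (h • x) (Fr.lift s (h • x))‖ ^ 2 = ‖B x (Fr.lift s x)‖ ^ 2 := by
    intro s h x
    rw [← (hsum s x).tsum_eq, ← (hsum s (h • x)).tsum_eq,
      ← (Equiv.mulRight h).tsum_eq (fun g : G => ‖W s (g • x)‖ ^ 2)]
    simp [mul_smul]
  refine ⟨fun s => ?_, fun c s x => ?_, ?_⟩
  · obtain ⟨C, hC⟩ := exists_bound_of_invariant ((hb s).norm.pow 2) (hinv s)
    have hC' : ∀ x, ‖W s x‖ ^ 2 ≤ C := fun x => by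
      have h1 := (hsum s x).summable.le_tsum 1 fun _ _ => sq_nonneg _
      rw [(hsum s x).tsum_eq, one_smul] at h1
      exact h1.trans (hC x)
    refine ⟨?_, ⟨Real.sqrt C, fun x => Real.le_sqrt_of_sq_le (hC' x)⟩,
      fun x => (hsum s x).summable, ?_, C, fun x => ?_⟩
    · have h1 := (lp.evalCLM ℂ (fun _ : G => ℂ) 2 1).continuous.comp (hb s)
      exact h1.congr fun x => (hW s x).symm
    · exact ((hb s).norm.pow 2).congr fun x => (hsum s x).tsum_eq.symm
    · rw [(hsum s x).tsum_eq]
      exact hC x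
  · rw [hW, hW, Fr.lift_mul, map_smul, lp.coeFn_smul]
    rfl
  · have key : ∀ f : Xt → ℂ, ∃ t : Sec d E, IsXi G f → ∀ (s : Sec d E) (x : Xt),
        xiInner G (W s) f x = inner ℂ (s.1 (proj G x)) (t.1 (proj G x)) := by
      intro f
      by_cases hf : IsXi G f
      swap
      · exact ⟨0, fun h => absurd h hf⟩
      have hVc : Continuous fun x => ContinuousLinearMap.adjoint (B x) (hf.orbit x) :=
        (ContinuousLinearMap.adjoint.continuous.comp hBc).clm_apply hf.continuous_orbit
      have hVe : ∀ (h : G) x, ContinuousLinearMap.adjoint (B (h • x)) (hf.orbit (h • x)) =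
          Fr.change h x (ContinuousLinearMap.adjoint (B x) (hf.orbit x)) := fun h x => by
        refine ext_inner_left ℂ fun u => ?_
        obtain ⟨u, rfl⟩ := (Fr.change h x).surjective u
        rw [LinearIsometryEquiv.inner_map_map, ContinuousLinearMap.adjoint_inner_right,
          ContinuousLinearMap.adjoint_inner_right, lp.inner_eq_tsum, lp.inner_eq_tsum,
          ← (Equiv.mulRight h).tsum_eq (fun g : G => inner ℂ (B x u g) (hf.orbit x g))]
        refine tsum_congr fun g => ?_
        rw [hequi, IsXi.orbit_apply, IsXi.orbit_apply, Equiv.coe_mulRight, mul_smul]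
      obtain ⟨t, ht⟩ := Fr.exists_section hVc hVe
      refine ⟨t, fun _ s x => ?_⟩
      rw [← Fr.inner_lift, ht, ContinuousLinearMap.adjoint_inner_right, lp.inner_eq_tsum]
      refine tsum_congr fun g => ?_
      rw [hWg, IsXi.orbit_apply, RCLike.inner_apply, mul_comm]
    choose Wadj hWadj using key
    exact ⟨Wadj, hWadj⟩

end Hom

/-! ### The iterates of the refinement operator along an orbit -/

section Iterates

set_option linter.unusedSectionVars false

variable {G Xt : Type*} [Group G] [MetricSpace Xt] [MulAction G Xt]
  {d : ℕ} {E : Orb G Xt → Type*}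
  [∀ x, NormedAddCommGroup (E x)] [∀ x, InnerProductSpace ℂ (E x)]
  [TopologicalSpace (TotalSpace (Cd d) E)] [FiberBundle (Cd d) E] [VectorBundle ℂ (Cd d) E]
  {D : Dilation G Xt} {Fr : Frame d E}

/-- Any finite sum over `G` is dominated by sums over the cosets of the image of `A`. -/
theorem Dilation.exists_sum_le_sum_coset (D : Dilation G Xt) (F : Finset G) :
    ∃ F' : Finset G, ∀ φ : G → ℝ, (∀ g, 0 ≤ φ g) →
      ∑ g ∈ F, φ g ≤ ∑ i, ∑ h ∈ F', φ (D.A h * D.rep i) := by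
  classical
  choose a i hai using D.exists_coset
  refine ⟨F.image a, fun φ hφ => ?_⟩
  have hinj : Set.InjOn (fun g => (i g, a g)) (F : Set G) := fun g _ g' _ h => by
    rw [hai g, hai g', (Prod.mk.inj h).1, (Prod.mk.inj h).2]
  rw [← Finset.sum_product']
  calc ∑ g ∈ F, φ g = ∑ p ∈ F.image fun g => (i g, a g), φ (D.A p.2 * D.rep p.1) := by
        rw [Finset.sum_image hinj]
        exact Finset.sum_congr rfl fun g _ => by rw [← hai]
    _ ≤ _ := by
        refine Finset.sum_le_sum_of_subset_of_nonneg (fun p hp => ?_) fun _ _ _ => hφ _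
        obtain ⟨g, hg, rfl⟩ := Finset.mem_image.1 hp
        exact Finset.mem_product.2 ⟨Finset.mem_univ _, Finset.mem_image_of_mem a hg⟩

namespace Weight

variable (w : Weight D Fr) (f : Xt → ℂ) (s₀ : Sec d E)

theorem exists_norm_branch_sub_le [IsIsometricSMul G Xt] [LocallyCompactSpace Xt]
    (hm : ∀ x, ‖w.mat x‖ ≤ 1) (R : ℝ) : ∃ K : ℝ, ∀ i, ∀ x ∈ Metric.closedBall D.x0 R,
      ∀ y ∈ Metric.closedBall D.x0 R, ‖w.branch i x - w.branch i y‖ ≤ K * dist x y := by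
  obtain ⟨K, hK⟩ := w.lipschitz_m
  have hlip : ∀ i, ∃ L : ℝ≥0, LipschitzOnWith L (Fr.changeL (D.rep i))
      (Metric.closedBall D.x0 R) := fun i =>
    (Fr.locallyLipschitz_changeL (D.rep i)).locallyLipschitzOn.exists_lipschitzOnWith_of_compact
      (D.isCompact_closedBall R)
  choose L hL using hlip
  refine ⟨K * D.θ + ∑ i, (L i : ℝ), fun i x hx y hy => ?_⟩
  have hch : ‖Fr.changeL (D.rep i) x‖ ≤ 1 :=
    ContinuousLinearMap.opNorm_le_bound _ zero_le_one fun v => by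
      rw [one_mul, Fr.changeL_apply, LinearIsometryEquiv.norm_map]
  have h1 : w.branch i x - w.branch i y =
      (w.mat (D.psi i x) - w.mat (D.psi i y)) * Fr.changeL (D.rep i) x +
        w.mat (D.psi i y) * (Fr.changeL (D.rep i) x - Fr.changeL (D.rep i) y) := by
    rw [sub_mul, mul_sub, sub_add_sub_cancel]
    rfl
  have h2 : ‖w.mat (D.psi i x) - w.mat (D.psi i y)‖ ≤ K * (D.θ * dist x y) := by
    rw [← dist_eq_norm]
    exact (hK.dist_le_mul _ _).trans (mul_le_mul_of_nonneg_left (D.dist_psi_le i x y) K.2)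
  have h3 : ‖Fr.changeL (D.rep i) x - Fr.changeL (D.rep i) y‖ ≤ L i * dist x y := by
    rw [← dist_eq_norm]
    exact (hL i).dist_le_mul x hx y hy
  have h4 : (L i : ℝ) * dist x y ≤ (∑ i, (L i : ℝ)) * dist x y :=
    mul_le_mul_of_nonneg_right (Finset.single_le_sum (f := fun i => (L i : ℝ))
      (fun i _ => (L i).2) (Finset.mem_univ i)) dist_nonneg
  rw [h1]
  calc _ ≤ K * (D.θ * dist x y) + L i * dist x y :=
        (norm_add_le _ _).trans (add_le_add
          ((norm_mul_le _ _).trans ((mul_le_of_le_one_right (norm_nonneg _) hch).trans h2))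
          ((norm_mul_le _ _).trans ((mul_le_of_le_one_left (norm_nonneg _) (hm _)).trans h3)))
    _ ≤ _ := by linarith

/-- The value at `g x` of the `k`-th iterate of the refinement operator on `⟨s₀, ·⟩ f`, applied to
a section whose coordinates at `x` are `u`. -/
noncomputable def coef (k : ℕ) (x : Xt) (u : Cd d) (g : G) : ℂ :=
  inner ℂ (Fr.lift s₀ (D.rt.symm^[k] (g • x))) (w.prodBack k (g • x) (Fr.change g x u)) *
    f (D.rt.symm^[k] (g • x))

theorem coef_zero (x : Xt) (u : Cd d) (g : G) :
    w.coef f s₀ 0 x u g = inner ℂ (Fr.lift s₀ x) u * f (g • x) := by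
  simp [coef, prodBack_zero, Fr.lift_smul]

/-- Along the coset `A G g_i` the next iterate is the previous one on the branch `ψ i`. -/
theorem coef_succ (k : ℕ) (x : Xt) (u : Cd d) (h : G) (i : Fin D.q) :
    w.coef f s₀ (k + 1) x u (D.A h * D.rep i) =
      w.coef f s₀ k (D.psi i x) (w.branch i x u) h := by
  rw [coef, coef, prodBack_succ', ContinuousLinearMap.comp_apply, mat_symm_change,
    Function.iterate_succ_apply, symm_smul]

theorem coef_sub (k : ℕ) (x : Xt) (u v : Cd d) (g : G) :
    w.coef f s₀ k x (u - v) g = w.coef f s₀ k x u g - w.coef f s₀ k x v g := by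
  simp [coef, sub_mul]

theorem refine_iterate_rankOne (k : ℕ) (s : Sec d E) (x : Xt) :
    (w.refine^[k] (rankOne f s₀)) s x =
      inner ℂ (Fr.lift s₀ (D.rt.symm^[k] x)) (w.prodBack k x (Fr.lift s x)) *
        f (D.rt.symm^[k] x) := by
  induction k generalizing s x with
  | zero =>
    rw [prodBack_zero]
    exact congrArg (· * f x) (Fr.inner_lift s₀ s x).symm
  | succ k ih =>
    rw [Function.iterate_succ_apply', Function.iterate_succ_apply, prodBack_succ']
    refine (ih (w.act s) (D.rt.symm x)).trans ?_
    rw [w.lift_act, Homeomorph.apply_symm_apply]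
    rfl

section Estimates

variable {w f s₀}
  (hR : ∀ x : Xt, w.transfer (fun y => ContinuousLinearMap.id ℂ (E y)) x =
    ContinuousLinearMap.id ℂ (E (proj G x)))
  {R : ℝ} (hRψ : ∀ i, ∀ x ∈ Metric.closedBall D.x0 R, D.psi i x ∈ Metric.closedBall D.x0 R)
  {S : ℝ} (hS : ∀ x ∈ Metric.closedBall D.x0 R, ‖Fr.lift s₀ x‖ ≤ S)
  {M : ℝ} (hM : ∀ x, ∀ F : Finset G, ∑ g ∈ F, ‖f (g • x)‖ ^ 2 ≤ M)

include hR hRψ hS hM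

theorem sum_norm_coef_sq_le (k : ℕ) {x : Xt} (hx : x ∈ Metric.closedBall D.x0 R) (u : Cd d)
    (F : Finset G) : ∑ g ∈ F, ‖w.coef f s₀ k x u g‖ ^ 2 ≤ S ^ 2 * M * ‖u‖ ^ 2 := by
  induction k generalizing x u F with
  | zero =>
    have h1 : ‖(inner ℂ (Fr.lift s₀ x) u : ℂ)‖ ^ 2 ≤ (S * ‖u‖) ^ 2 :=
      pow_le_pow_left₀ (norm_nonneg _) ((norm_inner_le_norm _ _).trans
        (mul_le_mul_of_nonneg_right (hS x hx) (norm_nonneg _))) 2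
    calc _ = ‖(inner ℂ (Fr.lift s₀ x) u : ℂ)‖ ^ 2 * ∑ g ∈ F, ‖f (g • x)‖ ^ 2 := by
          simp only [coef_zero, norm_mul, mul_pow, Finset.mul_sum]
      _ ≤ (S * ‖u‖) ^ 2 * M := mul_le_mul h1 (hM x F)
          (Finset.sum_nonneg fun _ _ => sq_nonneg _) (sq_nonneg _)
      _ = _ := by ring
  | succ k ih =>
    obtain ⟨F', hF'⟩ := D.exists_sum_le_sum_coset F
    calc _ ≤ ∑ i, ∑ h ∈ F', ‖w.coef f s₀ k (D.psi i x) (w.branch i x u) h‖ ^ 2 := by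
          simpa only [coef_succ] using
            hF' (fun g => ‖w.coef f s₀ (k + 1) x u g‖ ^ 2) fun _ => sq_nonneg _
      _ ≤ ∑ i, S ^ 2 * M * ‖w.branch i x u‖ ^ 2 :=
          Finset.sum_le_sum fun i _ => ih (hRψ i x hx) _ _
      _ = _ := by rw [← Finset.mul_sum, w.sum_norm_branch_sq hR]

/-- Uniform Lipschitz bound in `ℓ²(G)` for all the iterates: passing from `k` to `k + 1` multiplies
the Lipschitz constant by at most `θ`, up to an additive term coming from the variation of the
branches. -/
theorem sum_norm_coef_sub_sq_le [IsIsometricSMul G Xt] {K : ℝ}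
    (hK : ∀ i, ∀ x ∈ Metric.closedBall D.x0 R, ∀ y ∈ Metric.closedBall D.x0 R,
      ‖w.branch i x - w.branch i y‖ ≤ K * dist x y)
    {Cf Ks Λ : ℝ}
    (hf : ∀ x y, ∀ F : Finset G, ∑ g ∈ F, ‖f (g • x) - f (g • y)‖ ^ 2 ≤ (Cf * dist x y) ^ 2)
    (hs : ∀ x y, ‖Fr.lift s₀ x - Fr.lift s₀ y‖ ≤ Ks * dist x y)
    (hΛ₀ : 2 * (S ^ 2 * Cf ^ 2 + Ks ^ 2 * M) ≤ Λ)
    (hΛ : D.q * (S ^ 2 * M * K ^ 2) / (1 - D.θ) ≤ (1 - D.θ) * Λ)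
    (k : ℕ) {x y : Xt} (hx : x ∈ Metric.closedBall D.x0 R) (hy : y ∈ Metric.closedBall D.x0 R)
    (u : Cd d) (F : Finset G) :
    ∑ g ∈ F, ‖w.coef f s₀ k x u g - w.coef f s₀ k y u g‖ ^ 2 ≤
      Λ * dist x y ^ 2 * ‖u‖ ^ 2 := by
  have hθ := D.θ_pos
  have hθ1 : 0 < 1 - D.θ := sub_pos.2 D.θ_lt_one
  induction k generalizing x y u F with
  | zero =>
    have h1 : ‖(inner ℂ (Fr.lift s₀ x) u : ℂ)‖ ^ 2 ≤ (S * ‖u‖) ^ 2 :=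
      pow_le_pow_left₀ (norm_nonneg _) ((norm_inner_le_norm _ _).trans
        (mul_le_mul_of_nonneg_right (hS x hx) (norm_nonneg _))) 2
    have h2 : ‖(inner ℂ (Fr.lift s₀ x - Fr.lift s₀ y) u : ℂ)‖ ^ 2 ≤ (Ks * dist x y * ‖u‖) ^ 2 :=
      pow_le_pow_left₀ (norm_nonneg _) ((norm_inner_le_norm _ _).trans
        (mul_le_mul_of_nonneg_right (hs x y) (norm_nonneg _))) 2
    have h3 : ∀ g : G, ‖w.coef f s₀ 0 x u g - w.coef f s₀ 0 y u g‖ ^ 2 ≤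
        2 * (‖(inner ℂ (Fr.lift s₀ x) u : ℂ)‖ ^ 2 * ‖f (g • x) - f (g • y)‖ ^ 2 +
          ‖(inner ℂ (Fr.lift s₀ x - Fr.lift s₀ y) u : ℂ)‖ ^ 2 * ‖f (g • y)‖ ^ 2) := fun g => by
      have h4 : w.coef f s₀ 0 x u g - w.coef f s₀ 0 y u g =
          inner ℂ (Fr.lift s₀ x) u * (f (g • x) - f (g • y)) +
            inner ℂ (Fr.lift s₀ x - Fr.lift s₀ y) u * f (g • y) := by
        rw [coef_zero, coef_zero, inner_sub_left]
        ring
      rw [h4, ← mul_pow, ← mul_pow, ← norm_mul, ← norm_mul]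
      exact (pow_le_pow_left₀ (norm_nonneg _) (norm_add_le _ _) 2).trans (add_sq_le)
    calc _ ≤ _ := Finset.sum_le_sum fun g _ => h3 g
      _ = 2 * (‖(inner ℂ (Fr.lift s₀ x) u : ℂ)‖ ^ 2 * ∑ g ∈ F, ‖f (g • x) - f (g • y)‖ ^ 2 +
          ‖(inner ℂ (Fr.lift s₀ x - Fr.lift s₀ y) u : ℂ)‖ ^ 2 * ∑ g ∈ F, ‖f (g • y)‖ ^ 2) := by
        rw [← Finset.mul_sum, Finset.sum_add_distrib, Finset.mul_sum, Finset.mul_sum]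
      _ ≤ 2 * ((S * ‖u‖) ^ 2 * (Cf * dist x y) ^ 2 + (Ks * dist x y * ‖u‖) ^ 2 * M) := by
        refine mul_le_mul_of_nonneg_left (add_le_add ?_ ?_) zero_le_two
        · exact mul_le_mul h1 (hf x y F) (Finset.sum_nonneg fun _ _ => sq_nonneg _) (sq_nonneg _)
        · exact mul_le_mul h2 (hM y F) (Finset.sum_nonneg fun _ _ => sq_nonneg _) (sq_nonneg _)
      _ = 2 * (S ^ 2 * Cf ^ 2 + Ks ^ 2 * M) * (dist x y ^ 2 * ‖u‖ ^ 2) := by ring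
      _ ≤ Λ * (dist x y ^ 2 * ‖u‖ ^ 2) := mul_le_mul_of_nonneg_right hΛ₀ (by positivity)
      _ = _ := by ring
  | succ k ih =>
    have hM0 : 0 ≤ M := by simpa using hM x ∅
    have hΛ0 : 0 ≤ Λ := le_trans (by positivity) hΛ₀
    -- Convexity of the square with the weights `θ` and `1 - θ`, which lets the constant contract.
    have hyoung : ∀ a b : ℂ, ‖a + b‖ ^ 2 ≤ ‖a‖ ^ 2 / D.θ + ‖b‖ ^ 2 / (1 - D.θ) := fun a b => by
      have h1 : ‖a‖ ^ 2 / D.θ + ‖b‖ ^ 2 / (1 - D.θ) - (‖a‖ + ‖b‖) ^ 2 =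
          ((1 - D.θ) * ‖a‖ - D.θ * ‖b‖) ^ 2 / (D.θ * (1 - D.θ)) := by
        field_simp
        ring
      have h2 : 0 ≤ ((1 - D.θ) * ‖a‖ - D.θ * ‖b‖) ^ 2 / (D.θ * (1 - D.θ)) := by positivity
      have h3 := pow_le_pow_left₀ (norm_nonneg _) (norm_add_le a b) 2
      linarith
    obtain ⟨F', hF'⟩ := D.exists_sum_le_sum_coset F
    have hi : ∀ i, ∑ h ∈ F', ‖w.coef f s₀ k (D.psi i x) (w.branch i x u) h -
        w.coef f s₀ k (D.psi i y) (w.branch i y u) h‖ ^ 2 ≤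
        D.θ * Λ * dist x y ^ 2 * ‖w.branch i x u‖ ^ 2 +
          S ^ 2 * M * K ^ 2 / (1 - D.θ) * dist x y ^ 2 * ‖u‖ ^ 2 := fun i => by
      have h1 := ih (hRψ i x hx) (hRψ i y hy) (w.branch i x u) F'
      have h2 := sum_norm_coef_sq_le hR hRψ hS hM k (hRψ i y hy)
        ((w.branch i x - w.branch i y) u) F'
      have h3 : ‖(w.branch i x - w.branch i y) u‖ ^ 2 ≤ (K * dist x y * ‖u‖) ^ 2 :=
        pow_le_pow_left₀ (norm_nonneg _) (ContinuousLinearMap.le_of_opNorm_le _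
          (hK i x hx y hy) u) 2
      have h4 : dist (D.psi i x) (D.psi i y) ^ 2 ≤ (D.θ * dist x y) ^ 2 :=
        pow_le_pow_left₀ dist_nonneg (D.dist_psi_le i x y) 2
      calc _ ≤ ∑ h ∈ F', (‖w.coef f s₀ k (D.psi i x) (w.branch i x u) h -
              w.coef f s₀ k (D.psi i y) (w.branch i x u) h‖ ^ 2 / D.θ +
            ‖w.coef f s₀ k (D.psi i y) ((w.branch i x - w.branch i y) u) h‖ ^ 2 / (1 - D.θ)) := by
            refine Finset.sum_le_sum fun h _ => ?_
            refine le_trans (le_of_eq ?_) (hyoung _ _)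
            rw [sub_apply, coef_sub, sub_add_sub_cancel]
        _ = _ / D.θ + _ / (1 - D.θ) := by
            rw [Finset.sum_add_distrib, Finset.sum_div, Finset.sum_div]
        _ ≤ Λ * (D.θ * dist x y) ^ 2 * ‖w.branch i x u‖ ^ 2 / D.θ +
            S ^ 2 * M * (K * dist x y * ‖u‖) ^ 2 / (1 - D.θ) := by
            gcongr
            · exact h1.trans (by gcongr)
            · exact h2.trans (by gcongr)
        _ = _ := by
            field_simp
    calc _ ≤ ∑ i, ∑ h ∈ F', ‖w.coef f s₀ k (D.psi i x) (w.branch i x u) h -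
            w.coef f s₀ k (D.psi i y) (w.branch i y u) h‖ ^ 2 := by
          simpa only [coef_succ] using
            hF' (fun g => ‖w.coef f s₀ (k + 1) x u g - w.coef f s₀ (k + 1) y u g‖ ^ 2)
              fun _ => sq_nonneg _
      _ ≤ _ := Finset.sum_le_sum fun i _ => hi i
      _ = (D.θ * Λ + D.q * (S ^ 2 * M * K ^ 2) / (1 - D.θ)) * (dist x y ^ 2 * ‖u‖ ^ 2) := by
          rw [Finset.sum_add_distrib, ← Finset.mul_sum, w.sum_norm_branch_sq hR, Finset.sum_const,
            Finset.card_univ, Fintype.card_fin, nsmul_eq_mul]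
          ring
      _ ≤ Λ * (dist x y ^ 2 * ‖u‖ ^ 2) :=
          mul_le_mul_of_nonneg_right (by linarith) (by positivity)
      _ = _ := by ring

end Estimates

end Weight

end Iterates

/-! ### The limit of the cascade -/

section Limit

set_option linter.unusedSectionVars false

variable {G Xt : Type*} [Group G] [MetricSpace Xt] [MulAction G Xt]
  {d : ℕ} {E : Orb G Xt → Type*}
  [∀ x, NormedAddCommGroup (E x)] [∀ x, InnerProductSpace ℂ (E x)]
  [TopologicalSpace (TotalSpace (Cd d) E)] [FiberBundle (Cd d) E] [VectorBundle ℂ (Cd d) E]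
  {D : Dilation G Xt} {Fr : Frame d E}

theorem tendsto_clm_apply {ι : Type*} {p : Filter ι} {T : ι → (Cd d →L[ℂ] Cd d)} {u : ι → Cd d}
    {T₀ : Cd d →L[ℂ] Cd d} {u₀ : Cd d} (hT : Tendsto T p (𝓝 T₀)) (hu : Tendsto u p (𝓝 u₀)) :
    Tendsto (fun i => T i (u i)) p (𝓝 (T₀ u₀)) :=
  (isBoundedBilinearMap_apply.continuous.tendsto (T₀, u₀)).comp (hT.prodMk_nhds hu)

theorem IsXi1.sum_norm_sub_sq_le [IsIsometricSMul G Xt] {f : Xt → ℂ} (hf : IsXi1 G f) :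
    ∃ C : ℝ, ∀ x y, ∀ F : Finset G, ∑ g ∈ F, ‖f (g • x) - f (g • y)‖ ^ 2 ≤ (C * dist x y) ^ 2 := by
  obtain ⟨hf, C, hC, h⟩ := hf
  refine ⟨C, fun x y F => ?_⟩
  have h1 : HasSum (fun g : G => ‖f (g • x) - f (g • y)‖ ^ 2) (‖hf.orbit x - hf.orbit y‖ ^ 2) :=
    EllTwo.hasSum_norm_sq (hf.orbit x - hf.orbit y)
  exact (h1.summable.sum_le_tsum F fun _ _ => sq_nonneg _).trans
    ((Real.sqrt_le_left (by positivity)).1 (h x y))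

/-- The map `s ↦ ⟨v, P(·) p^*s⟩ c`. -/
noncomputable def limitMap (Fr : Frame d E) (P : Xt → (Cd d →L[ℂ] Cd d)) (v : Cd d) (c : ℂ) :
    Sec d E →ₗ[ℂ] (Xt → ℂ) where
  toFun s := fun x => inner ℂ v (P x (Fr.lift s x)) * c
  map_add' s t := by
    ext x
    simp [Fr.lift_add, add_mul]
  map_smul' a s := by
    ext x
    simp [Fr.lift_smul_left, mul_assoc]

theorem limitMap_apply (P : Xt → (Cd d →L[ℂ] Cd d)) (v : Cd d) (c : ℂ) (s : Sec d E) (x : Xt) :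
    limitMap Fr P v c s x = inner ℂ v (P x (Fr.lift s x)) * c := rfl

theorem isHom_rankOne [IsIsometricSMul G Xt] [CompactSpace (Orb G Xt)] (Fr : Frame d E)
    {f : Xt → ℂ} (hf : IsXi G f) (s₀ : Sec d E) : IsHom (rankOne f s₀) := by
  refine isHom_of_ellTwo Fr _ (fun x => (innerSL ℂ (Fr.lift s₀ x)).smulRight (hf.orbit x))
    (fun u => ?_) (fun h x u g => ?_) fun s x => ?_
  · exact ((Fr.continuous_lift s₀).inner (𝕜 := ℂ) (continuous_const (y := u))).smul
      hf.continuous_orbit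
  · simp only [ContinuousLinearMap.smulRight_apply, innerSL_apply_apply, lp.coeFn_smul,
      Pi.smul_apply, IsXi.orbit_apply, Fr.lift_smul, LinearIsometryEquiv.inner_map_map, mul_smul]
  · simp only [ContinuousLinearMap.smulRight_apply, innerSL_apply_apply, lp.coeFn_smul,
      Pi.smul_apply, IsXi.orbit_apply, one_smul, Fr.inner_lift]
    rfl

theorem continuous_of_tendstoUniformlyOn_prodBack (w : Weight D Fr)
    {P : Xt → (Cd d →L[ℂ] Cd d)} (hP : ∀ K : Set Xt, Bornology.IsBounded K →
      TendstoUniformlyOn w.prodBack P atTop K) : Continuous P := by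
  obtain ⟨K, hK⟩ := w.lipschitz_m
  have hmat : Continuous w.mat := hK.continuous
  have hc : ∀ k, Continuous (w.prodBack k) := by
    intro k
    induction k with
    | zero => exact continuous_const
    | succ k ih =>
      simp only [funext (w.prodBack_succ k)]
      exact (hmat.comp (D.rt.symm.continuous.iterate _)).clm_comp ih
  refine TendstoLocallyUniformly.continuous (F := w.prodBack) (p := atTop)
    (fun u hu x => ?_) (Frequently.of_forall hc)
  exact ⟨Metric.ball x 1, Metric.ball_mem_nhds x one_pos, hP _ Metric.isBounded_ball u hu⟩

/-- Uniform convergence of the cascade on compact sets. -/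
theorem Weight.tendstoUniformlyOn_refine (w : Weight D Fr)
    {P : Xt → (Cd d →L[ℂ] Cd d)} (hP : ∀ K : Set Xt, Bornology.IsBounded K →
      TendstoUniformlyOn w.prodBack P atTop K) {f : Xt → ℂ} (hf : Continuous f) (s₀ s : Sec d E)
    {K : Set Xt} (hK : IsCompact K) :
    TendstoUniformlyOn (fun (k : ℕ) x => (w.refine^[k] (rankOne f s₀)) s x)
      (limitMap Fr P (Fr.lift s₀ D.x0) (f D.x0) s) atTop K := by
  have hPc := continuous_of_tendstoUniformlyOn_prodBack w hP
  have hl := Fr.continuous_lift s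
  have hlim : Continuous (limitMap Fr P (Fr.lift s₀ D.x0) (f D.x0) s) :=
    (continuous_const.inner (hPc.clm_apply hl)).mul continuous_const
  rw [← tendstoLocallyUniformlyOn_iff_tendstoUniformlyOn_of_compact hK,
    tendstoLocallyUniformlyOn_iff_forall_tendsto]
  intro x hx
  have hsnd : Tendsto (Prod.snd : ℕ × Xt → Xt) (atTop ×ˢ 𝓝[K] x) (𝓝[K] x) := tendsto_snd
  have hsnd' := hsnd.mono_right nhdsWithin_le_nhds
  have h1 : Tendsto (fun q : ℕ × Xt => w.prodBack q.1 q.2) (atTop ×ˢ 𝓝[K] x) (𝓝 (P x)) := by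
    refine TendstoUniformlyOn.tendsto_comp (F := fun q : ℕ × Xt => w.prodBack q.1) (s := K)
      (fun u hu => ?_) hPc.continuousWithinAt hsnd
    exact tendsto_fst.eventually (hP K hK.isBounded u hu)
  have h2 : Tendsto (fun q : ℕ × Xt => D.rt.symm^[q.1] q.2) (atTop ×ˢ 𝓝[K] x) (𝓝 D.x0) := by
    refine TendstoUniformlyOn.tendsto_comp (F := fun q : ℕ × Xt => D.rt.symm^[q.1]) (s := K)
      (f := fun _ => D.x0) (fun u hu => ?_) continuousWithinAt_const hsnd
    exact tendsto_fst.eventually (D.tendstoUniformlyOn_symm_iterate hK.isBounded u hu)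
  have h3 : Tendsto (fun q : ℕ × Xt => (w.refine^[q.1] (rankOne f s₀)) s q.2)
      (atTop ×ˢ 𝓝[K] x) (𝓝 (limitMap Fr P (Fr.lift s₀ D.x0) (f D.x0) s x)) := by
    simp only [w.refine_iterate_rankOne, limitMap_apply]
    exact ((((Fr.continuous_lift s₀).tendsto _).comp h2).inner
      (tendsto_clm_apply h1 ((hl.tendsto x).comp hsnd'))).mul ((hf.tendsto _).comp h2)
  exact (((hlim.tendsto x).comp hsnd').prodMk_nhds h3).mono_right (nhds_le_uniformity _)

/-- The limit of the cascade belongs to `Hom(S, Ξ)`: the uniform bounds on the iterates pass to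
the limit along finite sums, and give strong continuity in `ℓ²(G)`. -/
theorem Weight.isHom_limitMap [IsIsometricSMul G Xt] [LocallyCompactSpace Xt]
    [CompactSpace (Orb G Xt)] (w : Weight D Fr)
    (hR : ∀ x : Xt, w.transfer (fun y => ContinuousLinearMap.id ℂ (E y)) x =
      ContinuousLinearMap.id ℂ (E (proj G x)))
    {P : Xt → (Cd d →L[ℂ] Cd d)} (hP : ∀ x, Tendsto (fun k => w.prodBack k x) atTop (𝓝 (P x)))
    {f : Xt → ℂ} (hf : IsXi1 G f) {s₀ : Sec d E} (hs₀ : Fr.IsLip s₀) :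
    IsHom (limitMap Fr P (Fr.lift s₀ D.x0) (f D.x0)) := by
  have hl := Fr.continuous_lift s₀
  obtain ⟨Ks, hKs⟩ := hs₀
  obtain ⟨Cf, hCf⟩ := hf.sum_norm_sub_sq_le
  obtain ⟨hfc, -, hfs, -, M, hM⟩ := hf.1
  have hM' : ∀ x, ∀ F : Finset G, ∑ g ∈ F, ‖f (g • x)‖ ^ 2 ≤ M := fun x F =>
    ((hfs x).sum_le_tsum F fun _ _ => sq_nonneg _).trans (hM x)
  obtain ⟨R₀, hR₀⟩ := D.exists_invariant_radius
  have hs : ∀ x y, ‖Fr.lift s₀ x - Fr.lift s₀ y‖ ≤ Ks * dist x y := fun x y => by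
    rw [← dist_eq_norm]
    exact hKs.dist_le_mul x y
  set c : Xt → Cd d → G → ℂ := fun x u g =>
    inner ℂ (Fr.lift s₀ D.x0) (P (g • x) (Fr.change g x u)) * f D.x0 with hc
  have hlim : ∀ x u g, Tendsto (fun k => w.coef f s₀ k x u g) atTop (𝓝 (c x u g)) :=
    fun x u g => by
      have h := D.tendsto_symm_iterate (g • x)
      exact (((hl.tendsto _).comp h).inner (tendsto_clm_apply (hP (g • x)) tendsto_const_nhds)).mul
        ((hfc.tendsto _).comp h)
  have hS : ∀ R, ∃ S, ∀ x ∈ Metric.closedBall D.x0 R, ‖Fr.lift s₀ x‖ ≤ S := fun R =>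
    (D.isCompact_closedBall R).exists_bound_of_continuousOn hl.continuousOn
  have hsum : ∀ x u, Summable fun g => ‖c x u g‖ ^ 2 := fun x u => by
    obtain ⟨S, hS⟩ := hS (max R₀ (dist x D.x0))
    refine summable_of_sum_le (c := S ^ 2 * M * ‖u‖ ^ 2) (fun _ => sq_nonneg _) fun F => ?_
    refine le_of_tendsto' (tendsto_finsetSum F fun g _ => (hlim x u g).norm.pow 2) fun k => ?_
    exact sum_norm_coef_sq_le hR (hR₀ _ (le_max_left _ _)) hS hM' k
      (Metric.mem_closedBall.2 (le_max_right _ _)) u F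
  have hcont : ∀ R ≥ R₀, ∃ Λ : ℝ, ∀ x ∈ Metric.closedBall D.x0 R,
      ∀ y ∈ Metric.closedBall D.x0 R, ∀ u, ∀ F : Finset G,
        ∑ g ∈ F, ‖c x u g - c y u g‖ ^ 2 ≤ Λ * dist x y ^ 2 * ‖u‖ ^ 2 := by
    intro R hRR
    obtain ⟨S, hS⟩ := hS R
    obtain ⟨K, hK⟩ := w.exists_norm_branch_sub_le (w.norm_mat_le hR) R
    have hθ : 0 < 1 - D.θ := sub_pos.2 D.θ_lt_one
    -- The second entry is the fixed point of the recursion for the Lipschitz constants.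
    refine ⟨max (2 * (S ^ 2 * Cf ^ 2 + Ks ^ 2 * M))
      (D.q * (S ^ 2 * M * K ^ 2) / (1 - D.θ) / (1 - D.θ)), fun x hx y hy u F => ?_⟩
    refine le_of_tendsto' (tendsto_finsetSum F fun g _ =>
      ((hlim x u g).sub (hlim y u g)).norm.pow 2) fun k => ?_
    refine sum_norm_coef_sub_sq_le hR (hR₀ R hRR) hS hM' hK hCf hs (le_max_left _ _) ?_ k hx hy u F
    rw [mul_comm (1 - D.θ), ← div_le_iff₀ hθ]
    exact le_max_right _ _
  let B : Xt → (Cd d →L[ℂ] EllTwo G) := fun x => LinearMap.toContinuousLinearMap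
    { toFun := fun u => ⟨c x u, memℓp_two (hsum x u)⟩
      map_add' := fun u v => by
        refine Subtype.ext (funext fun g => ?_)
        simp only [hc, map_add, inner_add_right, add_mul]
        rfl
      map_smul' := fun a u => by
        refine Subtype.ext (funext fun g => ?_)
        simp only [hc, map_smul, inner_smul_right, mul_assoc]
        rfl }
  have hBc : ∀ x u g, B x u g = c x u g := fun _ _ _ => rfl
  refine isHom_of_ellTwo Fr _ B (fun u => ?_) (fun h x u g => ?_) fun s x => ?_
  · refine continuous_iff_continuousAt.2 fun x => ?_
    obtain ⟨Λ, hΛ⟩ := hcont (max R₀ (dist x D.x0 + 1)) (le_max_left _ _)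
    have hev : ∀ᶠ y in 𝓝 x, ‖B y u - B x u‖ ^ 2 ≤ Λ * dist y x ^ 2 * ‖u‖ ^ 2 := by
      filter_upwards [Metric.ball_mem_nhds x one_pos] with y hy
      have h1 := EllTwo.hasSum_norm_sq (B y u - B x u)
      refine hasSum_le_of_sum_le h1 fun F => hΛ y ?_ x ?_ u F
      · refine Metric.mem_closedBall.2 (le_trans ?_ (le_max_right _ _))
        have := dist_triangle y x D.x0
        rw [Metric.mem_ball] at hy
        linarith
      · exact Metric.mem_closedBall.2 (le_trans (le_add_of_nonneg_right zero_le_one)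
          (le_max_right _ _))
    have hz : Tendsto (fun y => Λ * dist y x ^ 2 * ‖u‖ ^ 2) (𝓝 x) (𝓝 0) := by
      have h2 : Tendsto (fun y => dist y x) (𝓝 x) (𝓝 0) := by
        simpa using (continuous_id.dist (continuous_const (y := x))).tendsto x
      simpa using ((h2.pow 2).const_mul Λ).mul_const (‖u‖ ^ 2)
    have hn := squeeze_zero' (Eventually.of_forall fun _ => sq_nonneg _) hev hz
    rw [ContinuousAt, tendsto_iff_norm_sub_tendsto_zero]
    simpa [Real.sqrt_sq] using hn.sqrt
  · simp only [hBc, hc, mul_smul, Fr.change_mul]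
  · rw [hBc, limitMap_apply]
    simp only [hc, one_smul, Fr.change_one]

end Limit

end Cascade

theorem mainTheorem3 {G Xt : Type*} [Group G] [MetricSpace Xt] [MulAction G Xt]
    [IsIsometricSMul G Xt] [LocallyCompactSpace Xt] [CompactSpace (Cascade.Orb G Xt)]
    {d : ℕ} {E : Cascade.Orb G Xt → Type*}
    [∀ x, NormedAddCommGroup (E x)] [∀ x, InnerProductSpace ℂ (E x)]
    [TopologicalSpace (TotalSpace (Cascade.Cd d) E)] [FiberBundle (Cascade.Cd d) E]
    [VectorBundle ℂ (Cascade.Cd d) E]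
    (D : Cascade.Dilation G Xt) (Fr : Cascade.Frame d E) (w : Cascade.Weight D Fr)
    (hR : ∀ x : Xt, w.transfer (fun y => ContinuousLinearMap.id ℂ (E y)) x =
      ContinuousLinearMap.id ℂ (E (Cascade.proj G x)))
    (l : ℕ) (hE : Cascade.SatisfiesE l (w.mat D.x0)) :
    ∃ P : Xt → (Cascade.Cd d →L[ℂ] Cascade.Cd d),
      (∀ K : Set Xt, IsCompact K →
        TendstoUniformlyOn (fun (k : ℕ) x => w.prod k (D.rt.symm^[k] x)) P atTop K) ∧
      (∀ x, P (D.rt.symm x) ∘L w.mat (D.rt.symm x) = P x) ∧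
      P D.x0 = (Cascade.E1 (w.mat D.x0)).starProjection ∧
      (∀ x v, P x v ∈ Cascade.E1 (w.mat D.x0)) ∧
      (∀ x, w.mat D.x0 ∘L P x = P x) ∧
      (∀ g : G, g ≠ 1 → ∀ v ∈ Cascade.E1 (w.mat D.x0),
        P (g • D.x0) (Fr.change g D.x0 v) = 0) ∧
      ∀ f : Xt → ℂ, Cascade.IsXi1 G f → (∀ x, Cascade.xiInner G f f x = 1) →
        (∀ g : G, g ≠ 1 → f (g • D.x0) = 0) →
        ∃ 𝒲 : E (Cascade.proj G D.x0) → (Cascade.Sec d E →ₗ[ℂ] (Xt → ℂ)),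
          ∀ (s₀ : Cascade.Sec d E), Fr.IsLip s₀ →
          ∀ v : E (Cascade.proj G D.x0), s₀.1 (Cascade.proj G D.x0) = v →
            Cascade.IsHom (Cascade.rankOne f s₀) ∧
            (∀ (s : Cascade.Sec d E) (K : Set Xt), IsCompact K →
              TendstoUniformlyOn (fun (k : ℕ) x => (w.refine^[k] (Cascade.rankOne f s₀)) s x)
                (𝒲 v s) atTop K) ∧
            (∀ (s : Cascade.Sec d E) (x : Xt),
              𝒲 v s x = inner ℂ ((Fr.σ D.x0).symm v) (P x (Fr.lift s x)) * f D.x0) ∧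
            Cascade.IsHom (𝒲 v) ∧
            w.refine (𝒲 v) = 𝒲 v ∧
            (∀ s : Cascade.Sec d E,
              𝒲 v s D.x0 = inner ℂ (P D.x0 ((Fr.σ D.x0).symm v)) (Fr.lift s D.x0) * f D.x0) := by
  have hm := w.norm_mat_le hR
  obtain ⟨P, hP⟩ := w.exists_tendstoUniformlyOn_prodBack hm hE.2.2.2.1
  have hlim : ∀ x, Tendsto (fun k => w.prodBack k x) atTop (𝓝 (P x)) := fun x =>
    (hP {x} Bornology.isBounded_singleton).tendsto_at rfl
  have hP1 : ∀ x, P (D.rt.symm x) ∘L w.mat (D.rt.symm x) = P x := fun x => by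
    refine tendsto_nhds_unique ?_ ((tendsto_add_atTop_iff_nat 1).2 (hlim x))
    simp only [w.prodBack_succ']
    exact (hlim (D.rt.symm x)).mul tendsto_const_nhds
  have hP0 : P D.x0 = (Cascade.E1 (w.mat D.x0)).starProjection := by
    refine tendsto_nhds_unique (hlim D.x0) ?_
    simp only [w.prodBack_x0]
    exact Cascade.tendsto_pow_starProjection_E1 (hm _) hE.2.2.2.1
  have hP2 : ∀ x, w.mat D.x0 ∘L P x = P x := fun x => by
    obtain ⟨K, hK⟩ := w.lipschitz_m
    have hmat : Tendsto (fun k => w.mat (D.rt.symm^[k + 1] x)) atTop (𝓝 (w.mat D.x0)) :=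
      (hK.continuous.tendsto D.x0).comp
        ((tendsto_add_atTop_iff_nat 1).2 (D.tendsto_symm_iterate x))
    refine tendsto_nhds_unique ?_ ((tendsto_add_atTop_iff_nat 1).2 (hlim x))
    simp only [w.prodBack_succ]
    exact hmat.mul (hlim x)
  refine ⟨P, fun K hK => hP K hK.isBounded, hP1, hP0,
    fun x v => Cascade.mem_E1.2 (DFunLike.congr_fun (hP2 x) v), hP2,
    fun g hg v hv => w.apply_change_x0_eq_zero hR hP1 hg hv, fun f hf _ _ => ?_⟩
  refine ⟨fun v => Cascade.limitMap Fr P ((Fr.σ D.x0).symm v) (f D.x0), ?_⟩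
  rintro s₀ hs₀ v rfl
  refine ⟨Cascade.isHom_rankOne Fr hf.1 s₀,
    fun s K hK => w.tendstoUniformlyOn_refine hP hf.1.1 s₀ s hK, fun s x => rfl,
    w.isHom_limitMap hR hlim hf hs₀, LinearMap.ext fun s => funext fun x => ?_, fun s => ?_⟩
  · change inner ℂ _ (P (D.rt.symm x) (Fr.lift (w.act s) (D.rt.symm x))) * _ =
      inner ℂ _ (P x (Fr.lift s x)) * _
    rw [w.lift_act, Homeomorph.apply_symm_apply, ← hP1 x]
    rfl
  · rw [Cascade.limitMap_apply, hP0, Submodule.inner_starProjection_left_eq_right]
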